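/- **Proposition 3.3 (Conditional CMC Hölder Closure).** Let $n\ge 1$ and let $M^n\to\mathbb{R}^{n+1}$ be a smooth immersed hypersurface with smooth unit normal $\nu$ and constant mean curvature $H$; that is, with $g$ the induced metric and $A=(h_{ij})$ the second fundamental form with respect to $\nu$, $\frac1n g^{ij}h_{ij}\equiv H$. (Completeness is not assumed.) Let $\mathring{A}=A-Hg$ be the traceless second fundamental form, $u=|\mathring{A}|$, and let $dv_M$ be the Riemannian volume measure of $g$. Assume that $M$ is strongly stable: $$\int_M |A|^2\phi^2\,dv_M\le\int_M|\nabla\phi|^2\,dv_M\qquad\text{for all }\phi\in C_c^\infty(M).$$ Let $0<q<\sqrt{2/n}$, and assume that there are constants $C_0>0$ and $B_0\ge 0$ such that $$\int_M u^{2q}f^{2+2q}|\nabla u|^2\,dv_M\le C_0\int_M u^{2+2q}f^{2q}|\nabla f|^2\,dv_M+B_0H^2\int_M u^{2+2q}f^{2+2q}\,dv_M$$ for every $f\in C_c^\infty(M)$ with $0\le f\le 1$ (the integrand on the left is understood to be $0$ where $u=0$). Then, for every $f\in C_c^\infty(M)$ with $0\le f\le 1$, $$\int_M u^{4+2q}f^{2+2q}\,dv_M\le\mathcal{C}_1\int_M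 u^2|\nabla f|^{2+2q}\,dv_M+\mathcal{C}_2|H|^{2+2q}\int_M u^2f^{2+2q}\,dv_M,$$ where $$\mathcal{C}_1=2^q\bigl(2(1+q)^2(C_0+1)\bigr)^{1+q},\qquad \mathcal{C}_2=2^q\bigl(\max\{0,\,2(1+q)^2B_0-n\}\bigr)^{1+q}.$$ -/

import Mathlib

open MeasureTheory Matrix
open scoped Manifold ContDiff

noncomputable section

/-- A smooth (two-sided) immersed hypersurface `M^n → ℝ^{n+1}`: a smooth immersion of an
`n`-manifold `M`, together with the smooth unit normal field with respect to which the scalar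
second fundamental form and the scalar mean curvature are taken.  Embedded hypersurfaces
`M ⊆ ℝ^{n+1}` are the case where `toFun` is the inclusion.  Neither completeness nor compactness
nor connectedness is required. -/
structure Hypersurface (n : ℕ) (M : Type*) [TopologicalSpace M]
    [ChartedSpace (EuclideanSpace ℝ (Fin n)) M] where
  /-- the immersion -/
  toFun : M → EuclideanSpace ℝ (Fin (n + 1))
  /-- the unit normal field -/
  normal : M → EuclideanSpace ℝ (Fin (n + 1))
  smooth_toFun : ContMDiff (𝓡 n) 𝓘(ℝ, EuclideanSpace ℝ (Fin (n + 1))) ∞ toFun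
  smooth_normal : ContMDiff (𝓡 n) 𝓘(ℝ, EuclideanSpace ℝ (Fin (n + 1))) ∞ normal
  immersion : ∀ x : M, Function.Injective
    (mfderiv (𝓡 n) 𝓘(ℝ, EuclideanSpace ℝ (Fin (n + 1))) toFun x)
  norm_normal : ∀ x : M, ‖normal x‖ = 1
  normal_orthogonal : ∀ (x : M) (v : TangentSpace (𝓡 n) x),
    inner ℝ (normal x)
      (mfderiv (𝓡 n) 𝓘(ℝ, EuclideanSpace ℝ (Fin (n + 1))) toFun x v :
        EuclideanSpace ℝ (Fin (n + 1))) = 0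

namespace Hypersurface

variable {n : ℕ} {M : Type*} [TopologicalSpace M] [ChartedSpace (EuclideanSpace ℝ (Fin n)) M]

/-- The coordinate tangent vector `∂_i` at `x` (for the preferred chart at `x`, which is the one
Mathlib uses to identify the tangent space at `x` with `ℝ^n`). -/
def coordVec (x : M) (i : Fin n) : TangentSpace (𝓡 n) x :=
  (EuclideanSpace.single i (1 : ℝ) : EuclideanSpace ℝ (Fin n))

/-- The partial derivative `∂_i F` at `x` of a vector-valued map `F` on `M`. -/
def partialVec (F : M → EuclideanSpace ℝ (Fin (n + 1))) (x : M) (i : Fin n) :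
    EuclideanSpace ℝ (Fin (n + 1)) :=
  mfderiv (𝓡 n) 𝓘(ℝ, EuclideanSpace ℝ (Fin (n + 1))) F x (coordVec x i)

/-- The partial derivative `∂_i f` at `x` of a real function `f` on `M`. -/
def partialReal (f : M → ℝ) (x : M) (i : Fin n) : ℝ :=
  mfderiv (𝓡 n) 𝓘(ℝ, ℝ) f x (coordVec x i)

variable (S : Hypersurface n M)

/-- The induced metric `g_{ij} = ⟨∂_i X, ∂_j X⟩`, where `X` is the immersion. -/
def metric (x : M) : Matrix (Fin n) (Fin n) ℝ :=
  Matrix.of fun i j => inner ℝ (partialVec S.toFun x i) (partialVec S.toFun x j)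

/-- The second fundamental form `h_{ij} = -⟨∂_i ν, ∂_j X⟩ = ⟨∂_i ∂_j X, ν⟩`, where `ν` is the unit
normal. -/
def secondForm (x : M) : Matrix (Fin n) (Fin n) ℝ :=
  Matrix.of fun i j => -inner ℝ (partialVec S.normal x i) (partialVec S.toFun x j)

/-- The squared norm `g^{ik} g^{jl} T_{ij} T_{kl}` of a 2-tensor at `x`. -/
def tensorNormSq (x : M) (T : Matrix (Fin n) (Fin n) ℝ) : ℝ :=
  ∑ i, ∑ j, ∑ k, ∑ l, (S.metric x)⁻¹ i k * (S.metric x)⁻¹ j l * T i j * T k l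

/-- The (normalized) mean curvature `(1/n) g^{ij} h_{ij}`. -/
def meanCurvature (x : M) : ℝ :=
  (1 / (n : ℝ)) * ∑ i, ∑ j, (S.metric x)⁻¹ i j * S.secondForm x i j

/-- The squared norm `|A|²` of the second fundamental form. -/
def secondFormNormSq (x : M) : ℝ := S.tensorNormSq x (S.secondForm x)

/-- The traceless second fundamental form `Å = A - H g`. -/
def tracelessForm (x : M) : Matrix (Fin n) (Fin n) ℝ :=
  S.secondForm x - S.meanCurvature x • S.metric x

/-- The norm `u = |Å|` of the traceless second fundamental form. -/
def tracelessNorm (x : M) : ℝ := Real.sqrt (S.tensorNormSq x (S.tracelessForm x))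

/-- The norm `|∇f| = (g^{ij} ∂_i f ∂_j f)^{1/2}` of the gradient of `f` for the induced metric. -/
def gradNorm (f : M → ℝ) (x : M) : ℝ :=
  Real.sqrt (∑ i, ∑ j, (S.metric x)⁻¹ i j * partialReal f x i * partialReal f x j)

/-- The volume density `√det(g_{ij})` of the induced metric in the chart `c`, as a function of
the coordinates `y` in the target of `c`. -/
def chartDensity (c : OpenPartialHomeomorph M (EuclideanSpace ℝ (Fin n)))
    (y : EuclideanSpace ℝ (Fin n)) : ℝ :=
  Real.sqrt (Matrix.det (Matrix.of fun i j : Fin n =>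
    (inner ℝ (fderiv ℝ (S.toFun ∘ c.symm) y (EuclideanSpace.single i (1 : ℝ)))
      (fderiv ℝ (S.toFun ∘ c.symm) y (EuclideanSpace.single j (1 : ℝ))) : ℝ)))

/-- The Riemannian volume of the domain of the chart `c`: the measure `√det(g_{ij}) dy` on the
target of `c`, transported to `M`. -/
def chartVolume [MeasurableSpace M] (c : OpenPartialHomeomorph M (EuclideanSpace ℝ (Fin n))) :
    Measure M :=
  Measure.map c.symm
    ((volume.restrict c.target).withDensity fun y => ENNReal.ofReal (S.chartDensity c y))

/-- The Riemannian volume measure `dv_M` of the induced metric.  The measures `chartVolume` agree on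
the overlaps of the charts, so that their supremum (in the lattice of measures) is the
measure on `M` whose restriction to each chart domain is `√det(g_{ij}) dy`. -/
def vol [MeasurableSpace M] : Measure M :=
  ⨆ x : M, S.chartVolume (chartAt (EuclideanSpace ℝ (Fin n)) x)

/-- `S` has constant mean curvature `H`. -/
def IsCMC (H : ℝ) : Prop := ∀ x : M, S.meanCurvature x = H

/-- Strong stability: `∫ |A|² φ² ≤ ∫ |∇φ|²` for every `φ ∈ C_c^∞(M)`. -/
def StronglyStable [MeasurableSpace M] : Prop :=
  ∀ φ : M → ℝ, ContMDiff (𝓡 n) 𝓘(ℝ, ℝ) ∞ φ → HasCompactSupport φ →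
    ∫ x, S.secondFormNormSq x * φ x ^ 2 ∂S.vol ≤ ∫ x, S.gradNorm φ x ^ 2 ∂S.vol

/-- Cutoff functions: `f ∈ C_c^∞(M)` with `0 ≤ f ≤ 1`. -/
def IsCutoff (n : ℕ) {M : Type*} [TopologicalSpace M]
    [ChartedSpace (EuclideanSpace ℝ (Fin n)) M] (f : M → ℝ) : Prop :=
  ContMDiff (𝓡 n) 𝓘(ℝ, ℝ) ∞ f ∧ HasCompactSupport f ∧ ∀ x, 0 ≤ f x ∧ f x ≤ 1

/-- The gradient estimate
`∫ u^{2q} f^{2+2q} |∇u|² ≤ C₀ ∫ u^{2+2q} f^{2q} |∇f|² + B₀ H² ∫ u^{2+2q} f^{2+2q}`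
for every cutoff function `f`, where `u = |Å|`.  (At a point with `u = 0`, the only points where
`u` may fail to be differentiable, the first integrand is `0` because `q > 0`.) -/
def GradientEstimate [MeasurableSpace M] (H q C₀ B₀ : ℝ) : Prop :=
  ∀ f : M → ℝ, IsCutoff n f →
    ∫ x, S.tracelessNorm x ^ (2 * q) * f x ^ (2 + 2 * q)
        * S.gradNorm S.tracelessNorm x ^ 2 ∂S.vol
      ≤ C₀ * ∫ x, S.tracelessNorm x ^ (2 + 2 * q) * f x ^ (2 * q) * S.gradNorm f x ^ 2 ∂S.vol
        + B₀ * H ^ 2 * ∫ x, S.tracelessNorm x ^ (2 + 2 * q) * f x ^ (2 + 2 * q) ∂S.vol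

end Hypersurface

end

/-!
The stability inequality is tested with `φ = (u f)^{1+q}`, where `u = |Å|`.  Since
`|A|² = u² + n H²` (`IsCMC.secondFormNormSq_eq`) and
`|∇φ|² ≤ 2 (1+q)² (u^{2q} f^{2+2q} |∇u|² + u^{2+2q} f^{2q} |∇f|²)`, this together with the assumed
gradient estimate bounds `L = ∫ u^{4+2q} f^{2+2q}` by
`a ∫ u^{2+2q} f^{2q} |∇f|² + b H² ∫ u^{2+2q} f^{2+2q}` with `a = 2 (1+q)² (C₀+1)` and
`b = max 0 (2 (1+q)² B₀ - n)`.  By Hölder's inequality with exponents `(1+q)/q` and `1+q`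
(`integral_rpow_mul_rpow_le`), both integrals are at most `L^{q/(1+q)}` times the `1/(1+q)`-th power
of the integral wanted on the right, and `L^{q/(1+q)}` is absorbed
(`Real.le_of_le_rpow_mul_add`).

The function `(u f)^{1+q}` is not smooth, so it is replaced by
`(u² f² + δ)^{(1+q)/2} - δ^{(1+q)/2}` with `δ → 0` (`stabilityTest`).  As
`t ↦ t^{q-1}` is antitone for `q ≤ 1`, the bound for `|∇φ|²` already holds for every `δ > 0`
(`IsCMC.gradNorm_stabilityTest_sq_le`), and only the left-hand side of the stability inequality
needs a passage to the limit (`IsCMC.stability_rpow`).  If `q > 1` then `q < √(2/n)` leaves only `n = 1`,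
where `u = 0`.

The integrals are Bochner integrals, so each integrand has to be shown integrable.  This takes
three facts.

* `u²` is smooth and `|∇u²| ≤ 2 u K` with `K` continuous.  With `J` the Jacobian matrix of the
  immersion in a chart and `R = J (Jᵀ J)⁻¹`, a covector `a` and a bilinear form `T` on the tangent
  space become the vector `R a` and the matrix `R T Rᵀ` in the ambient Euclidean space, with the
  same norms and independently of the chart.  Thus `u²` is a sum of squares of smooth functions, and
  the bound is the Cauchy–Schwarz inequality
  (`IsCMC.exists_norm_gradVec_tracelessNorm_sq_le`).
* Where `u > 0`, `|∇u²| = 2 u |∇u|`; hence `u^{2q} |∇u|² ≤ u^{2q} K²` everywhere.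
* Compact sets have finite volume (`vol_lt_top_of_isCompact`).  The chart volumes agree on overlaps
  by the change of variables formula, so over a compact set covered by finitely many small chart
  domains the supremum defining `vol` is at most a finite sum of finite chart volumes.
-/

noncomputable section

/-! ### The coframe of a Jacobian matrix -/

section Coframe
variable {m n : ℕ}

/-- For a Jacobian matrix `J`, whose columns are the coordinate vectors `∂_i X`, the matrix
`J (Jᵀ J)⁻¹`.  Its columns are the dual basis of the tangent space: `g^{ij} ∂_j X`. -/
def coframe (J : Matrix (Fin m) (Fin n) ℝ) : Matrix (Fin m) (Fin n) ℝ := J * (Jᵀ * J)⁻¹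

theorem coframe_transpose_mul_self {J : Matrix (Fin m) (Fin n) ℝ} (hJ : (Jᵀ * J).det ≠ 0) :
    (coframe J)ᵀ * coframe J = (Jᵀ * J)⁻¹ := by
  have hu : IsUnit (Jᵀ * J).det := isUnit_iff_ne_zero.2 hJ
  have hs : ((Jᵀ * J)⁻¹)ᵀ = (Jᵀ * J)⁻¹ := by
    rw [transpose_nonsing_inv, transpose_mul, transpose_transpose]
  rw [coframe, transpose_mul, hs, Matrix.mul_assoc, ← Matrix.mul_assoc Jᵀ,
    Matrix.mul_nonsing_inv _ hu, Matrix.mul_one]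

/-- The transformation law under a change of coordinates with Jacobian `P`, which makes the
ambient gradient and the ambient second fundamental form independent of the chart. -/
theorem coframe_mul (J : Matrix (Fin m) (Fin n) ℝ) {P : Matrix (Fin n) (Fin n) ℝ}
    (hP : P.det ≠ 0) : coframe (J * P) * Pᵀ = coframe J := by
  have hu : IsUnit P.det := isUnit_iff_ne_zero.2 hP
  have hu' : IsUnit Pᵀ.det := by rwa [det_transpose]
  have h : (J * P)ᵀ * (J * P) = Pᵀ * ((Jᵀ * J) * P) := by
    simp only [transpose_mul, Matrix.mul_assoc]
  rw [coframe, h, Matrix.mul_inv_rev, Matrix.mul_inv_rev, coframe]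
  calc J * P * (P⁻¹ * (Jᵀ * J)⁻¹ * Pᵀ⁻¹) * Pᵀ
      = J * (P * P⁻¹) * (Jᵀ * J)⁻¹ * (Pᵀ⁻¹ * Pᵀ) := by simp only [Matrix.mul_assoc]
    _ = _ := by
      rw [Matrix.mul_nonsing_inv _ hu, Matrix.nonsing_inv_mul _ hu', Matrix.mul_one,
        Matrix.mul_one]

/-- The vector `R a` in the ambient space has the squared norm `g^{ij} a_i a_j`. -/
theorem sum_coframe_mulVec_sq {J : Matrix (Fin m) (Fin n) ℝ} (hJ : (Jᵀ * J).det ≠ 0)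
    (a : Fin n → ℝ) :
    ∑ k, (coframe J *ᵥ a) k ^ 2 = ∑ i, ∑ j, (Jᵀ * J)⁻¹ i j * a i * a j := by
  have h : ∑ k, (coframe J *ᵥ a) k ^ 2 = (coframe J *ᵥ a) ⬝ᵥ (coframe J *ᵥ a) := by
    simp only [dotProduct, sq]
  rw [h, Matrix.dotProduct_mulVec, ← Matrix.mulVec_transpose, Matrix.mulVec_mulVec,
    coframe_transpose_mul_self hJ]
  simp only [dotProduct, mulVec, Finset.sum_mul]
  rw [Finset.sum_comm]
  refine Finset.sum_congr rfl fun i _ => Finset.sum_congr rfl fun j _ => ?_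
  have hs : ((Jᵀ * J)⁻¹)ᵀ = (Jᵀ * J)⁻¹ := by
    rw [transpose_nonsing_inv, transpose_mul, transpose_transpose]
  rw [← hs, transpose_apply, hs]

/-- The matrix `R T Rᵀ` has the squared Frobenius norm `g^{ik} g^{jl} T_{ij} T_{kl}`. -/
theorem sum_coframe_conj_sq {J : Matrix (Fin m) (Fin n) ℝ} (hJ : (Jᵀ * J).det ≠ 0)
    (T : Matrix (Fin n) (Fin n) ℝ) :
    ∑ p : Fin m × Fin m, (coframe J * T * (coframe J)ᵀ) p.1 p.2 ^ 2
      = ∑ i, ∑ j, ∑ k, ∑ l, (Jᵀ * J)⁻¹ i k * (Jᵀ * J)⁻¹ j l * T i j * T k l := by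
  set R := coframe J
  have hs : ((Jᵀ * J)⁻¹)ᵀ = (Jᵀ * J)⁻¹ := by
    rw [transpose_nonsing_inv, transpose_mul, transpose_transpose]
  have h1 : ∑ p : Fin m × Fin m, (R * T * Rᵀ) p.1 p.2 ^ 2
      = ((R * T * Rᵀ) * (R * T * Rᵀ)ᵀ).trace := by
    rw [Fintype.sum_prod_type]
    simp only [trace, diag, Matrix.mul_apply (M := R * T * Rᵀ), transpose_apply, sq]
  have h2 : ((R * T * Rᵀ) * (R * T * Rᵀ)ᵀ).trace = (T * (Rᵀ * R) * Tᵀ * (Rᵀ * R)).trace := by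
    calc _ = (R * (T * (Rᵀ * R) * Tᵀ * Rᵀ)).trace := by
          simp only [transpose_mul, transpose_transpose, Matrix.mul_assoc]
      _ = _ := by rw [Matrix.trace_mul_comm]; simp only [Matrix.mul_assoc]
  rw [h1, h2, coframe_transpose_mul_self hJ]
  generalize (Jᵀ * J)⁻¹ = Q at hs
  have hQ : ∀ i j, Q i j = Q j i := fun i j => by rw [← hs, transpose_apply, hs]
  simp only [trace, diag, Matrix.mul_apply, transpose_apply, Finset.sum_mul]
  refine Finset.sum_congr rfl fun i _ => ?_
  symm
  rw [Finset.sum_comm]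
  refine Finset.sum_congr rfl fun k _ => ?_
  rw [Finset.sum_comm]
  refine Finset.sum_congr rfl fun l _ => Finset.sum_congr rfl fun j _ => ?_
  rw [hQ k i]; ring

theorem contDiffOn_matrix_det {E : Type*} [NormedAddCommGroup E] [NormedSpace ℝ E] {k : ℕ}
    {s : Set E} {r : WithTop ℕ∞} {A : E → Matrix (Fin k) (Fin k) ℝ}
    (hA : ∀ i j, ContDiffOn ℝ r (fun y => A y i j) s) : ContDiffOn ℝ r (fun y => (A y).det) s := by
  simp only [det_apply]
  refine ContDiffOn.sum fun σ _ => ?_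
  exact (contDiffOn_prod fun i _ => hA _ _).const_smul _

theorem contDiffOn_matrix_inv {E : Type*} [NormedAddCommGroup E] [NormedSpace ℝ E] {k : ℕ}
    {s : Set E} {r : WithTop ℕ∞} {A : E → Matrix (Fin k) (Fin k) ℝ}
    (hA : ∀ i j, ContDiffOn ℝ r (fun y => A y i j) s) (hd : ∀ y ∈ s, (A y).det ≠ 0) (i j : Fin k) :
    ContDiffOn ℝ r (fun y => (A y)⁻¹ i j) s := by
  simp only [Matrix.inv_def, Ring.inverse_eq_inv', Matrix.smul_apply, smul_eq_mul]
  refine ((contDiffOn_matrix_det hA).inv hd).mul ?_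
  simp only [adjugate_apply]
  refine contDiffOn_matrix_det fun a b => ?_
  by_cases h : a = j
  · subst h; simp only [updateRow_self]; exact contDiffOn_const
  · simp only [updateRow_ne h]; exact hA _ _

theorem contDiffOn_matrix_mul {E : Type*} [NormedAddCommGroup E] [NormedSpace ℝ E] {k l p : ℕ}
    {s : Set E} {r : WithTop ℕ∞} {A : E → Matrix (Fin k) (Fin l) ℝ}
    {B : E → Matrix (Fin l) (Fin p) ℝ}
    (hA : ∀ i j, ContDiffOn ℝ r (fun y => A y i j) s)
    (hB : ∀ i j, ContDiffOn ℝ r (fun y => B y i j) s) (i : Fin k) (j : Fin p) :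
    ContDiffOn ℝ r (fun y => (A y * B y) i j) s := by
  simp only [Matrix.mul_apply]
  exact ContDiffOn.sum fun a _ => (hA _ _).mul (hB _ _)

theorem contDiffOn_coframe {E : Type*} [NormedAddCommGroup E] [NormedSpace ℝ E]
    {s : Set E} {r : WithTop ℕ∞} {J : E → Matrix (Fin m) (Fin n) ℝ}
    (hJ : ∀ i j, ContDiffOn ℝ r (fun y => J y i j) s)
    (hd : ∀ y ∈ s, ((J y)ᵀ * J y).det ≠ 0) (i : Fin m) (j : Fin n) :
    ContDiffOn ℝ r (fun y => coframe (J y) i j) s :=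
  contDiffOn_matrix_mul hJ (contDiffOn_matrix_inv
    (contDiffOn_matrix_mul (fun i j => hJ j i) hJ) hd) i j

end Coframe

/-! ### Hölder's inequality and absorption -/

/-- Hölder's inequality for the exponents `(1+q)/q` and `1+q`. -/
theorem integral_rpow_mul_rpow_le {α : Type*} [MeasurableSpace α] {μ : Measure α} {q : ℝ}
    (hq : 0 < q) {F G : α → ℝ} (hF : Integrable F μ) (hG : Integrable G μ)
    (hF0 : ∀ x, 0 ≤ F x) (hG0 : ∀ x, 0 ≤ G x) :
    ∫ x, F x ^ (q / (1 + q)) * G x ^ (1 / (1 + q)) ∂μ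
      ≤ (∫ x, F x ∂μ) ^ (q / (1 + q)) * (∫ x, G x ∂μ) ^ (1 / (1 + q)) := by
  have hmem : ∀ {F : α → ℝ} {p : ℝ}, Integrable F μ → (∀ x, 0 ≤ F x) → 0 < p →
      MemLp (fun x => F x ^ (1 / p)) (ENNReal.ofReal p) μ := by
    intro F p hF hF0 hp
    refine (integrable_norm_rpow_iff ?_ (by simpa using hp) ENNReal.ofReal_ne_top).1 ?_
    · exact (hF.aemeasurable.pow_const _).aestronglyMeasurable
    · refine hF.congr (Filter.Eventually.of_forall fun x => ?_)
      simp only [ENNReal.toReal_ofReal hp.le]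
      rw [Real.norm_of_nonneg (Real.rpow_nonneg (hF0 x) _), ← Real.rpow_mul (hF0 x),
        one_div_mul_cancel hp.ne', Real.rpow_one]
  have hconj : ((1 + q) / q).HolderConjugate (1 + q) := by
    rw [Real.holderConjugate_iff]
    constructor
    · rw [lt_div_iff₀ hq]; linarith
    · field_simp; ring
  have h := integral_mul_le_Lp_mul_Lq_of_nonneg (μ := μ) hconj
    (Filter.Eventually.of_forall fun x => Real.rpow_nonneg (hF0 x) _)
    (Filter.Eventually.of_forall fun x => Real.rpow_nonneg (hG0 x) _)
    (hmem hF hF0 (p := (1 + q) / q) (by positivity)) (hmem hG hG0 (p := 1 + q) (by positivity))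
  have e1 : ∀ x, (F x ^ (q / (1 + q))) ^ ((1 + q) / q) = F x := fun x => by
    rw [← Real.rpow_mul (hF0 x), div_mul_div_cancel₀ (by positivity), div_self hq.ne',
      Real.rpow_one]
  have e2 : ∀ x, (G x ^ (1 / (1 + q))) ^ (1 + q) = G x := fun x => by
    rw [← Real.rpow_mul (hG0 x), one_div_mul_cancel (by positivity), Real.rpow_one]
  simp only [one_div_div, e1, e2] at h
  exact h

theorem Real.add_rpow_le_mul_rpow_add_rpow {a b p : ℝ} (ha : 0 ≤ a) (hb : 0 ≤ b) (hp : 1 ≤ p) :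
    (a + b) ^ p ≤ 2 ^ (p - 1) * (a ^ p + b ^ p) := by
  lift a to NNReal using ha
  lift b to NNReal using hb
  exact_mod_cast NNReal.rpow_add_le_mul_rpow_add_rpow a b hp

/-- Divide by `L^{q/(1+q)}` and raise to the power `1+q`; the factor `2^q` is the convexity
constant of `t ↦ t^{1+q}`. -/
theorem Real.le_of_le_rpow_mul_add {q L G E a b : ℝ} (hq : 0 < q) (hL : 0 ≤ L) (hG : 0 ≤ G)
    (hE : 0 ≤ E) (ha : 0 ≤ a) (hb : 0 ≤ b)
    (h : L ≤ a * (L ^ (q / (1 + q)) * G ^ (1 / (1 + q)))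
      + b * (L ^ (q / (1 + q)) * E ^ (1 / (1 + q)))) :
    L ≤ 2 ^ q * (a ^ (1 + q) * G + b ^ (1 + q) * E) := by
  rcases hL.eq_or_lt with rfl | hL0
  · positivity
  have hpos : 0 < L ^ (q / (1 + q)) := Real.rpow_pos_of_pos hL0 _
  have hsplit : L = L ^ (q / (1 + q)) * L ^ (1 / (1 + q)) := by
    rw [← Real.rpow_add hL0, ← add_div, add_comm q 1, div_self (by positivity), Real.rpow_one]
  have h1 : L ^ (1 / (1 + q)) ≤ a * G ^ (1 / (1 + q)) + b * E ^ (1 / (1 + q)) := by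
    refine le_of_mul_le_mul_left ?_ hpos
    rw [← hsplit]
    linarith
  have hroot : ∀ {z : ℝ}, 0 ≤ z → (z ^ (1 / (1 + q))) ^ (1 + q) = z := fun {z} hz => by
    rw [← Real.rpow_mul hz, one_div_mul_cancel (by positivity), Real.rpow_one]
  calc L = (L ^ (1 / (1 + q))) ^ (1 + q) := (hroot hL).symm
    _ ≤ (a * G ^ (1 / (1 + q)) + b * E ^ (1 / (1 + q))) ^ (1 + q) := by gcongr
    _ ≤ 2 ^ (1 + q - 1) * ((a * G ^ (1 / (1 + q))) ^ (1 + q)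
        + (b * E ^ (1 / (1 + q))) ^ (1 + q)) :=
        Real.add_rpow_le_mul_rpow_add_rpow (by positivity) (by positivity) (by linarith)
    _ = _ := by
        rw [Real.mul_rpow ha (by positivity), Real.mul_rpow hb (by positivity), hroot hG, hroot hE,
          add_sub_cancel_left]

/-- The integrands to which Hölder's inequality is applied, with `t` either `|∇f|` or `f`. -/
theorem Real.rpow_mul_rpow_holder_split {q u s t : ℝ} (hq : 0 < q) (hu : 0 ≤ u) (hs : 0 ≤ s)
    (ht : 0 ≤ t) :
    (u ^ (4 + 2 * q) * s ^ (2 + 2 * q)) ^ (q / (1 + q)) * (u ^ 2 * t ^ (2 + 2 * q)) ^ (1 / (1 + q))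
      = u ^ (2 + 2 * q) * s ^ (2 * q) * t ^ 2 := by
  rw [Real.mul_rpow (by positivity) (by positivity), Real.mul_rpow (by positivity) (by positivity),
    ← Real.rpow_natCast u 2, ← Real.rpow_mul hu, ← Real.rpow_mul hu, ← Real.rpow_mul hs,
    ← Real.rpow_mul ht, ← Real.rpow_natCast t 2]
  have e1 : (2 + 2 * q) * (q / (1 + q)) = 2 * q := by field_simp
  have e2 : (2 + 2 * q) * (1 / (1 + q)) = ((2 : ℕ) : ℝ) := by push_cast; field_simp
  have e3 : u ^ (2 + 2 * q) = u ^ ((4 + 2 * q) * (q / (1 + q)))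
      * u ^ (((2 : ℕ) : ℝ) * (1 / (1 + q))) := by
    rw [← Real.rpow_add_of_nonneg hu (by positivity) (by positivity)]
    congr 1; push_cast; field_simp; ring
  rw [e1, e2, e3]; ring

namespace Hypersurface

variable {n : ℕ} {M : Type*} [TopologicalSpace M] [ChartedSpace (EuclideanSpace ℝ (Fin n)) M]

/-! ### Jacobians and changes of charts -/

section Charts

/-- The Jacobian matrix, in the chart `c`, of a map into a Euclidean space, as a function of the
coordinates `y`. -/
def jacobian {p : ℕ} (F : M → EuclideanSpace ℝ (Fin p))
    (c : OpenPartialHomeomorph M (EuclideanSpace ℝ (Fin n))) (y : EuclideanSpace ℝ (Fin n)) :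
    Matrix (Fin p) (Fin n) ℝ :=
  Matrix.of fun a i => fderiv ℝ (F ∘ c.symm) y (EuclideanSpace.single i (1 : ℝ)) a

/-- The partial derivatives of a real function in the chart `c`. -/
def chartPartial (f : M → ℝ) (c : OpenPartialHomeomorph M (EuclideanSpace ℝ (Fin n)))
    (y : EuclideanSpace ℝ (Fin n)) : Fin n → ℝ :=
  fun i => fderiv ℝ (f ∘ c.symm) y (EuclideanSpace.single i (1 : ℝ))

/-- The Jacobian matrix of the transition map from the coordinates of `c` to those of `c'`. -/
def transition (c c' : OpenPartialHomeomorph M (EuclideanSpace ℝ (Fin n)))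
    (y : EuclideanSpace ℝ (Fin n)) : Matrix (Fin n) (Fin n) ℝ :=
  Matrix.of fun a i => fderiv ℝ (c' ∘ c.symm) y (EuclideanSpace.single i (1 : ℝ)) a

/-- Mathlib's `mfderiv` at `x` is the derivative in the preferred chart at `x`. -/
theorem mfderiv_eq_fderiv_chart {V : Type*} [NormedAddCommGroup V] [NormedSpace ℝ V] {F : M → V}
    {x : M} (hF : MDifferentiableAt (𝓡 n) 𝓘(ℝ, V) F x) (v : EuclideanSpace ℝ (Fin n)) :
    (mfderiv (𝓡 n) 𝓘(ℝ, V) F x : EuclideanSpace ℝ (Fin n) →L[ℝ] V) v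
      = fderiv ℝ (F ∘ (chartAt (EuclideanSpace ℝ (Fin n)) x).symm)
        (chartAt (EuclideanSpace ℝ (Fin n)) x x) v := by
  simp only [mfderiv, hF, writtenInExtChartAt, mfld_simps, fderivWithin_univ]
  rfl

theorem sum_fderiv_single {V : Type*} [NormedAddCommGroup V] [NormedSpace ℝ V]
    (L : EuclideanSpace ℝ (Fin n) →L[ℝ] V) (v : EuclideanSpace ℝ (Fin n)) :
    L v = ∑ j, v j • L (EuclideanSpace.single j (1 : ℝ)) := by
  conv_lhs => rw [← (EuclideanSpace.basisFun (Fin n) ℝ).sum_repr v]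
  simp

variable {c c' : OpenPartialHomeomorph M (EuclideanSpace ℝ (Fin n))}

theorem contDiffOn_comp_chart_symm {V : Type*} [NormedAddCommGroup V] [NormedSpace ℝ V] {F : M → V}
    (hF : ContMDiff (𝓡 n) 𝓘(ℝ, V) ∞ F) (hc : c ∈ IsManifold.maximalAtlas (𝓡 n) ∞ M) :
    ContDiffOn ℝ ∞ (F ∘ c.symm) c.target :=
  contMDiffOn_iff_contDiffOn.1 (hF.comp_contMDiffOn (contMDiffOn_symm_of_mem_maximalAtlas hc))

theorem contDiffOn_chart_comp_symm (hc : c ∈ IsManifold.maximalAtlas (𝓡 n) ∞ M)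
    (hc' : c' ∈ IsManifold.maximalAtlas (𝓡 n) ∞ M) :
    ContDiffOn ℝ ∞ (c' ∘ c.symm) (c.symm.trans c').source := by
  refine contMDiffOn_iff_contDiffOn.1 ((contMDiffOn_of_mem_maximalAtlas hc').comp
    ((contMDiffOn_symm_of_mem_maximalAtlas hc).mono ?_) ?_)
  · intro y hy; simp only [mfld_simps] at hy; exact hy.1
  · intro y hy; simp only [mfld_simps] at hy; exact hy.2

theorem hasFDerivAt_chart_comp_symm (hc : c ∈ IsManifold.maximalAtlas (𝓡 n) ∞ M)
    (hc' : c' ∈ IsManifold.maximalAtlas (𝓡 n) ∞ M) {x : M} (hx : x ∈ c.source)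
    (hx' : x ∈ c'.source) :
    HasFDerivAt (c' ∘ c.symm) (fderiv ℝ (c' ∘ c.symm) (c x)) (c x) := by
  refine DifferentiableAt.hasFDerivAt (((contDiffOn_chart_comp_symm hc hc').contDiffAt
    ((c.symm.trans c').open_source.mem_nhds ?_)).differentiableAt (by simp))
  simp only [mfld_simps]
  exact ⟨c.map_source hx, by rwa [c.left_inv hx]⟩

theorem fderiv_chart_change {V : Type*} [NormedAddCommGroup V] [NormedSpace ℝ V] {F : M → V}
    (hc : c ∈ IsManifold.maximalAtlas (𝓡 n) ∞ M)
    (hc' : c' ∈ IsManifold.maximalAtlas (𝓡 n) ∞ M) {x : M} (hx : x ∈ c.source)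
    (hx' : x ∈ c'.source) (hF : DifferentiableAt ℝ (F ∘ c'.symm) (c' x)) :
    fderiv ℝ (F ∘ c.symm) (c x)
      = (fderiv ℝ (F ∘ c'.symm) (c' x)).comp (fderiv ℝ (c' ∘ c.symm) (c x)) := by
  have h1 := hasFDerivAt_chart_comp_symm hc hc' hx hx'
  have h2 : HasFDerivAt (F ∘ c'.symm) (fderiv ℝ (F ∘ c'.symm) (c' x)) ((c' ∘ c.symm) (c x)) := by
    simp only [Function.comp_apply, c.left_inv hx]
    exact hF.hasFDerivAt
  refine ((h2.comp (c x) h1).congr_of_eventuallyEq ?_).fderiv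
  have hopen : (c.symm.trans c').source ∈ nhds (c x) :=
    (c.symm.trans c').open_source.mem_nhds (by
      simp only [mfld_simps]; exact ⟨c.map_source hx, by rwa [c.left_inv hx]⟩)
  filter_upwards [hopen] with y hy
  simp only [mfld_simps] at hy
  simp only [Function.comp_apply, c'.left_inv hy.2]

theorem transition_mul_transition (hc : c ∈ IsManifold.maximalAtlas (𝓡 n) ∞ M)
    (hc' : c' ∈ IsManifold.maximalAtlas (𝓡 n) ∞ M) {x : M} (hx : x ∈ c.source)
    (hx' : x ∈ c'.source) : transition c' c (c' x) * transition c c' (c x) = 1 := by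
  have h := fderiv_chart_change hc hc' hx hx' (F := c)
    (hasFDerivAt_chart_comp_symm hc' hc hx' hx).differentiableAt
  have hid : fderiv ℝ (c ∘ c.symm) (c x) = ContinuousLinearMap.id ℝ _ := by
    refine ((hasFDerivAt_id (c x)).congr_of_eventuallyEq ?_).fderiv
    filter_upwards [c.open_target.mem_nhds (c.map_source hx)] with y hy
    simp [c.right_inv hy]
  rw [hid] at h
  ext a i
  have := congrArg (fun L => (L (EuclideanSpace.single i (1 : ℝ))) a) h
  simp only [ContinuousLinearMap.id_apply, ContinuousLinearMap.comp_apply] at this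
  rw [sum_fderiv_single (fderiv ℝ (c ∘ c'.symm) (c' x))] at this
  simp only [Matrix.mul_apply, transition, Matrix.of_apply, Matrix.one_apply]
  rw [PiLp.single_apply] at this
  rw [this]
  simp [mul_comm]

theorem det_transition_ne_zero (hc : c ∈ IsManifold.maximalAtlas (𝓡 n) ∞ M)
    (hc' : c' ∈ IsManifold.maximalAtlas (𝓡 n) ∞ M) {x : M} (hx : x ∈ c.source)
    (hx' : x ∈ c'.source) : (transition c c' (c x)).det ≠ 0 := by
  intro h
  have := congrArg Matrix.det (transition_mul_transition hc hc' hx hx')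
  rw [det_mul, h, mul_zero, det_one] at this
  exact zero_ne_one this

theorem jacobian_chart_change {p : ℕ} {F : M → EuclideanSpace ℝ (Fin p)}
    (hF : ContMDiff (𝓡 n) 𝓘(ℝ, EuclideanSpace ℝ (Fin p)) ∞ F)
    (hc : c ∈ IsManifold.maximalAtlas (𝓡 n) ∞ M)
    (hc' : c' ∈ IsManifold.maximalAtlas (𝓡 n) ∞ M) {x : M} (hx : x ∈ c.source)
    (hx' : x ∈ c'.source) :
    jacobian F c (c x) = jacobian F c' (c' x) * transition c c' (c x) := by
  have hd : DifferentiableAt ℝ (F ∘ c'.symm) (c' x) :=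
    ((contDiffOn_comp_chart_symm hF hc').contDiffAt
      (c'.open_target.mem_nhds (c'.map_source hx'))).differentiableAt (by simp)
  ext a i
  simp only [jacobian, transition, Matrix.mul_apply, Matrix.of_apply]
  rw [fderiv_chart_change hc hc' hx hx' hd, ContinuousLinearMap.comp_apply,
    sum_fderiv_single (fderiv ℝ (F ∘ c'.symm) (c' x))]
  simp [mul_comm]

theorem chartPartial_chart_change {f : M → ℝ} (hf : ContMDiff (𝓡 n) 𝓘(ℝ, ℝ) ∞ f)
    (hc : c ∈ IsManifold.maximalAtlas (𝓡 n) ∞ M)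
    (hc' : c' ∈ IsManifold.maximalAtlas (𝓡 n) ∞ M) {x : M} (hx : x ∈ c.source)
    (hx' : x ∈ c'.source) :
    chartPartial f c (c x) = (transition c c' (c x))ᵀ *ᵥ chartPartial f c' (c' x) := by
  have hd : DifferentiableAt ℝ (f ∘ c'.symm) (c' x) :=
    ((contDiffOn_comp_chart_symm hf hc').contDiffAt
      (c'.open_target.mem_nhds (c'.map_source hx'))).differentiableAt (by simp)
  ext i
  simp only [chartPartial, transition, mulVec, dotProduct, Matrix.transpose_apply, Matrix.of_apply]
  rw [fderiv_chart_change hc hc' hx hx' hd, ContinuousLinearMap.comp_apply,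
    sum_fderiv_single (fderiv ℝ (f ∘ c'.symm) (c' x))]
  simp

theorem contDiffOn_fderiv_apply {V : Type*} [NormedAddCommGroup V] [NormedSpace ℝ V] {F : M → V}
    (hF : ContMDiff (𝓡 n) 𝓘(ℝ, V) ∞ F) (hc : c ∈ IsManifold.maximalAtlas (𝓡 n) ∞ M)
    (v : EuclideanSpace ℝ (Fin n)) :
    ContDiffOn ℝ ∞ (fun y => fderiv ℝ (F ∘ c.symm) y v) c.target :=
  ((contDiffOn_comp_chart_symm hF hc).fderiv_of_isOpen c.open_target (by simp)).clm_apply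
    contDiffOn_const

theorem contDiffOn_jacobian {p : ℕ} {F : M → EuclideanSpace ℝ (Fin p)}
    (hF : ContMDiff (𝓡 n) 𝓘(ℝ, EuclideanSpace ℝ (Fin p)) ∞ F)
    (hc : c ∈ IsManifold.maximalAtlas (𝓡 n) ∞ M) (a : Fin p) (i : Fin n) :
    ContDiffOn ℝ ∞ (fun y => jacobian F c y a i) c.target :=
  contDiffOn_euclidean.1 (contDiffOn_fderiv_apply hF hc _) a

/-- A function given in every chart by a smooth function of the coordinates is smooth.  It serves
for quantities whose definition at `x` refers to the preferred chart at `x`, which jumps with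
`x`. -/
theorem contMDiff_of_chart [IsManifold (𝓡 n) ∞ M] {g : M → ℝ}
    (G : OpenPartialHomeomorph M (EuclideanSpace ℝ (Fin n)) → EuclideanSpace ℝ (Fin n) → ℝ)
    (hG : ∀ c ∈ IsManifold.maximalAtlas (𝓡 n) ∞ M, ContDiffOn ℝ ∞ (G c) c.target)
    (hg : ∀ c ∈ IsManifold.maximalAtlas (𝓡 n) ∞ M, ∀ x ∈ c.source, g x = G c (c x)) :
    ContMDiff (𝓡 n) 𝓘(ℝ, ℝ) ∞ g := by
  intro x
  have hc := IsManifold.chart_mem_maximalAtlas (I := 𝓡 n) (n := ∞) x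
  set c := chartAt (EuclideanSpace ℝ (Fin n)) x
  have h : ContMDiffOn (𝓡 n) 𝓘(ℝ, ℝ) ∞ (G c ∘ c) c.source :=
    (contMDiffOn_iff_contDiffOn.2 (hG c hc)).comp (contMDiffOn_of_mem_maximalAtlas hc)
      (fun y hy => c.map_source hy)
  exact (h.congr (hg c hc)).contMDiffAt (c.open_source.mem_nhds (mem_chart_source _ x))

end Charts

/-! ### The induced metric in a chart -/

section Frame

variable (S : Hypersurface n M)

theorem metric_eq (x : M) : S.metric x
    = (jacobian S.toFun (chartAt _ x) (chartAt (EuclideanSpace ℝ (Fin n)) x x))ᵀ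
      * jacobian S.toFun (chartAt _ x) (chartAt (EuclideanSpace ℝ (Fin n)) x x) := by
  ext i j
  simp only [metric, partialVec, coordVec, Matrix.of_apply, Matrix.mul_apply,
    Matrix.transpose_apply, jacobian]
  have hd := (S.smooth_toFun x).mdifferentiableAt (by simp)
  erw [mfderiv_eq_fderiv_chart hd, mfderiv_eq_fderiv_chart hd]
  rw [PiLp.inner_apply]
  refine Finset.sum_congr rfl fun a _ => ?_
  simp [mul_comm]

theorem secondForm_eq (x : M) : S.secondForm x
    = -((jacobian S.normal (chartAt _ x) (chartAt (EuclideanSpace ℝ (Fin n)) x x))ᵀ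
      * jacobian S.toFun (chartAt _ x) (chartAt (EuclideanSpace ℝ (Fin n)) x x)) := by
  ext i j
  simp only [secondForm, partialVec, coordVec, Matrix.of_apply, Matrix.mul_apply,
    Matrix.transpose_apply, jacobian, Matrix.neg_apply]
  have hd := (S.smooth_toFun x).mdifferentiableAt (by simp)
  have hd' := (S.smooth_normal x).mdifferentiableAt (by simp)
  erw [mfderiv_eq_fderiv_chart hd, mfderiv_eq_fderiv_chart hd']
  rw [PiLp.inner_apply]
  congr 1
  refine Finset.sum_congr rfl fun a _ => ?_
  simp [mul_comm]

theorem det_metric_ne_zero (x : M) : (S.metric x).det ≠ 0 := by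
  intro h
  obtain ⟨v, hv, hv0⟩ := Matrix.exists_mulVec_eq_zero_iff.2 h
  rw [metric_eq] at hv0
  have hJ := (Matrix.self_mul_conjTranspose_mulVec_eq_zero
    (jacobian S.toFun (chartAt _ x) (chartAt (EuclideanSpace ℝ (Fin n)) x x))ᵀ v).1
    (by simpa [Matrix.conjTranspose_eq_transpose_of_trivial] using hv0)
  simp only [Matrix.conjTranspose_eq_transpose_of_trivial, Matrix.transpose_transpose] at hJ
  have hd := (S.smooth_toFun x).mdifferentiableAt (by simp)
  refine hv ?_
  have : (WithLp.toLp 2 v : EuclideanSpace ℝ (Fin n)) = 0 := by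
    refine S.immersion x ?_
    refine (mfderiv_eq_fderiv_chart hd _).trans ?_
    refine Eq.trans ?_ (map_zero
      (mfderiv (𝓡 n) 𝓘(ℝ, EuclideanSpace ℝ (Fin (n + 1))) S.toFun x)).symm
    rw [sum_fderiv_single]
    refine (WithLp.ofLp_injective 2 (funext fun a => ?_) : _ = (0 : EuclideanSpace ℝ (Fin (n + 1))))
    have := congrFun hJ a
    simp only [mulVec, dotProduct, jacobian, Matrix.of_apply] at this
    simpa [mul_comm] using this
  simpa using this

variable [IsManifold (𝓡 n) ∞ M] {c : OpenPartialHomeomorph M (EuclideanSpace ℝ (Fin n))}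

theorem det_gram_jacobian_ne_zero (hc : c ∈ IsManifold.maximalAtlas (𝓡 n) ∞ M)
    {y : EuclideanSpace ℝ (Fin n)} (hy : y ∈ c.target) :
    ((jacobian S.toFun c y)ᵀ * jacobian S.toFun c y).det ≠ 0 := by
  obtain ⟨x, hx, rfl⟩ : ∃ x ∈ c.source, c x = y := ⟨c.symm y, c.map_target hy, c.right_inv hy⟩
  have hc' := IsManifold.chart_mem_maximalAtlas (I := 𝓡 n) (n := ∞) x
  have hx' := mem_chart_source (EuclideanSpace ℝ (Fin n)) x
  have hP := det_transition_ne_zero hc hc' hx hx'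
  rw [jacobian_chart_change S.smooth_toFun hc hc' hx hx', transpose_mul, Matrix.mul_assoc,
    ← Matrix.mul_assoc _ _ (transition _ _ _), ← metric_eq, det_mul, det_mul, det_transpose]
  exact mul_ne_zero hP (mul_ne_zero (S.det_metric_ne_zero x) hP)

end Frame

/-! ### The gradient as a vector of the ambient space -/

section Gradient
variable (S : Hypersurface n M)

/-- The gradient of `f` at `x`, pushed forward to the ambient Euclidean space. -/
def gradVec (f : M → ℝ) (x : M) : EuclideanSpace ℝ (Fin (n + 1)) :=
  WithLp.toLp 2 (coframe (jacobian S.toFun (chartAt _ x) (chartAt (EuclideanSpace ℝ (Fin n)) x x))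
    *ᵥ partialReal f x)

theorem gradNorm_eq_norm_gradVec (f : M → ℝ) (x : M) : S.gradNorm f x = ‖S.gradVec f x‖ := by
  rw [EuclideanSpace.norm_eq, gradNorm]
  congr 1
  simp only [Real.norm_eq_abs, sq_abs, gradVec]
  rw [sum_coframe_mulVec_sq (by rw [← metric_eq]; exact S.det_metric_ne_zero x), ← metric_eq]

theorem partialReal_eq {f : M → ℝ} {x : M} (hf : MDifferentiableAt (𝓡 n) 𝓘(ℝ, ℝ) f x) :
    partialReal f x = chartPartial f (chartAt _ x) (chartAt (EuclideanSpace ℝ (Fin n)) x x) := by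
  ext i
  exact mfderiv_eq_fderiv_chart hf _

/-- The gradient depends linearly on the partial derivatives; the product and chain rules below
are instances. -/
theorem gradVec_eq_sum_smul {ι : Type*} [Fintype ι] {f : M → ℝ} {x : M} {a : ι → ℝ} {g : ι → M → ℝ}
    (h : ∀ i : Fin n, partialReal f x i = ∑ k, a k * partialReal (g k) x i) :
    S.gradVec f x = ∑ k, a k • S.gradVec (g k) x := by
  have h' : (partialReal f x : Fin n → ℝ) = ∑ k, a k • partialReal (g k) x := by
    ext i; rw [h i]; simp
  ext b
  simp only [gradVec, h', Matrix.mulVec_sum, Matrix.mulVec_smul]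
  simp

theorem gradVec_comp {f : M → ℝ} {x : M} {φ : ℝ → ℝ} {φ' : ℝ}
    (hf : MDifferentiableAt (𝓡 n) 𝓘(ℝ, ℝ) f x) (hφ : HasDerivAt φ φ' (f x)) :
    S.gradVec (fun y => φ (f y)) x = φ' • S.gradVec f x := by
  have h := S.gradVec_eq_sum_smul (f := fun y => φ (f y)) (x := x) (a := fun _ : Unit => φ')
    (g := fun _ => f) ?_
  · simpa using h
  intro i
  have h1 := (hφ.hasFDerivAt.hasMFDerivAt).comp x hf.hasMFDerivAt
  have h2 : partialReal (fun y => φ (f y)) x i = partialReal f x i * φ' :=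
    congrArg (fun L => L (coordVec x i)) h1.mfderiv
  rw [Fintype.sum_unique, h2, mul_comm]

theorem gradVec_mul {f g : M → ℝ} {x : M} (hf : MDifferentiableAt (𝓡 n) 𝓘(ℝ, ℝ) f x)
    (hg : MDifferentiableAt (𝓡 n) 𝓘(ℝ, ℝ) g x) :
    S.gradVec (fun y => f y * g y) x = f x • S.gradVec g x + g x • S.gradVec f x := by
  have h := S.gradVec_eq_sum_smul (f := fun y => f y * g y) (x := x) (a := ![f x, g x])
    (g := ![g, f]) ?_
  · simpa using h
  intro i
  have h1 := hf.hasMFDerivAt.mul hg.hasMFDerivAt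
  simp only [partialReal]
  erw [h1.mfderiv]
  simp
  rfl

theorem gradVec_eq_zero_of_eventuallyEq {f : M → ℝ} {x : M} (h : f =ᶠ[nhds x] fun _ => 0) :
    S.gradVec f x = 0 := by
  have : (partialReal f x : Fin n → ℝ) = 0 := by
    ext i
    simp only [partialReal, h.mfderiv_eq, mfderiv_const]
    rfl
  ext b
  simp [gradVec, this]

variable [IsManifold (𝓡 n) ∞ M] {c : OpenPartialHomeomorph M (EuclideanSpace ℝ (Fin n))}

theorem gradVec_sum_sq {ι : Type*} [Fintype ι] {E : ι → M → ℝ}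
    (hE : ∀ k, ContMDiff (𝓡 n) 𝓘(ℝ, ℝ) ∞ (E k)) (x : M) :
    S.gradVec (fun y => ∑ k, E k y ^ 2) x = ∑ k, (2 * E k x) • S.gradVec (E k) x := by
  refine S.gradVec_eq_sum_smul fun i => ?_
  have hd : ∀ k, MDifferentiableAt (𝓡 n) 𝓘(ℝ, ℝ) (E k) x := fun k =>
    (hE k x).mdifferentiableAt (by simp)
  have hs : ContMDiff (𝓡 n) 𝓘(ℝ, ℝ) ∞ (fun y => ∑ k, E k y ^ 2) :=
    contMDiff_finsetSum fun k _ => (hE k).pow 2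
  rw [partialReal_eq ((hs x).mdifferentiableAt (by simp))]
  simp only [partialReal_eq (hd _), chartPartial]
  set c := chartAt (EuclideanSpace ℝ (Fin n)) x
  have hk : ∀ k, HasFDerivAt (E k ∘ c.symm) (fderiv ℝ (E k ∘ c.symm) (c x)) (c x) := fun k =>
    (((contDiffOn_comp_chart_symm (hE k)
      (IsManifold.chart_mem_maximalAtlas (I := 𝓡 n) (n := ∞) x)).contDiffAt
      (c.open_target.mem_nhds (mem_chart_target _ x))).differentiableAt (by simp)).hasFDerivAt
  have := HasFDerivAt.fun_sum (u := Finset.univ) fun k _ => (hk k).pow 2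
  rw [show (fun y => ∑ k, E k y ^ 2) ∘ c.symm = fun y => ∑ k, (E k ∘ c.symm) y ^ 2 from rfl,
    this.fderiv]
  simp [c]

theorem gradVec_eq_chart {f : M → ℝ} (hf : ContMDiff (𝓡 n) 𝓘(ℝ, ℝ) ∞ f)
    (hc : c ∈ IsManifold.maximalAtlas (𝓡 n) ∞ M) {x : M} (hx : x ∈ c.source) :
    S.gradVec f x
      = WithLp.toLp 2 (coframe (jacobian S.toFun c (c x)) *ᵥ chartPartial f c (c x)) := by
  have hc' := IsManifold.chart_mem_maximalAtlas (I := 𝓡 n) (n := ∞) x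
  have hx' := mem_chart_source (EuclideanSpace ℝ (Fin n)) x
  rw [jacobian_chart_change S.smooth_toFun hc hc' hx hx',
    chartPartial_chart_change hf hc hc' hx hx', Matrix.mulVec_mulVec,
    coframe_mul _ (det_transition_ne_zero hc hc' hx hx'), gradVec,
    partialReal_eq ((hf x).mdifferentiableAt (by simp))]

theorem contMDiff_gradVec_apply {f : M → ℝ} (hf : ContMDiff (𝓡 n) 𝓘(ℝ, ℝ) ∞ f) (a : Fin (n + 1)) :
    ContMDiff (𝓡 n) 𝓘(ℝ, ℝ) ∞ (fun x => S.gradVec f x a) := by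
  refine contMDiff_of_chart
    (fun c y => (coframe (jacobian S.toFun c y) *ᵥ chartPartial f c y) a) ?_ ?_
  · intro c hc
    simp only [mulVec, dotProduct]
    exact ContDiffOn.sum fun i _ => (contDiffOn_coframe (contDiffOn_jacobian S.smooth_toFun hc)
      (fun y hy => S.det_gram_jacobian_ne_zero hc hy) _ _).mul (contDiffOn_fderiv_apply hf hc _)
  · intro c hc x hx
    rw [S.gradVec_eq_chart hf hc hx]

theorem continuous_gradVec {f : M → ℝ} (hf : ContMDiff (𝓡 n) 𝓘(ℝ, ℝ) ∞ f) :
    Continuous (S.gradVec f) := by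
  have : Continuous fun x => WithLp.toLp 2 (fun a => S.gradVec f x a) :=
    (PiLp.continuous_toLp 2 _).comp
      (continuous_pi fun a => (S.contMDiff_gradVec_apply hf a).continuous)
  exact this

end Gradient

/-! ### The traceless second fundamental form -/

section TracelessForm
variable (S : Hypersurface n M)

/-- The traceless second fundamental form `A - H g`, as a symmetric form on the ambient Euclidean
space which vanishes on the normal direction. -/
def ambientForm (H : ℝ) (x : M) : Matrix (Fin (n + 1)) (Fin (n + 1)) ℝ :=
  coframe (jacobian S.toFun (chartAt _ x) (chartAt (EuclideanSpace ℝ (Fin n)) x x))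
    * (S.secondForm x - H • S.metric x)
    * (coframe (jacobian S.toFun (chartAt _ x) (chartAt (EuclideanSpace ℝ (Fin n)) x x)))ᵀ

variable {S} {H : ℝ}

theorem IsCMC.tensorNormSq_tracelessForm (hH : S.IsCMC H) (x : M) :
    S.tensorNormSq x (S.tracelessForm x)
      = ∑ p : Fin (n + 1) × Fin (n + 1), S.ambientForm H x p.1 p.2 ^ 2 := by
  rw [tensorNormSq, tracelessForm, hH x, S.metric_eq x, ambientForm,
    sum_coframe_conj_sq (by rw [← metric_eq]; exact S.det_metric_ne_zero x), S.metric_eq x]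

theorem IsCMC.tracelessNorm_sq (hH : S.IsCMC H) (x : M) :
    S.tracelessNorm x ^ 2 = ∑ p : Fin (n + 1) × Fin (n + 1), S.ambientForm H x p.1 p.2 ^ 2 := by
  rw [tracelessNorm, hH.tensorNormSq_tracelessForm, Real.sq_sqrt]
  positivity

theorem sum_inv_mul_metric (x : M) : ∑ i, ∑ j, (S.metric x)⁻¹ i j * S.metric x i j = n := by
  have hu := isUnit_iff_ne_zero.2 (S.det_metric_ne_zero x)
  have h : ((S.metric x)⁻¹ * (S.metric x)ᵀ).trace = n := by
    rw [show (S.metric x)ᵀ = S.metric x by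
      rw [metric_eq, transpose_mul, transpose_transpose], Matrix.nonsing_inv_mul _ hu]
    simp
  rw [← h]
  simp only [trace, diag, Matrix.mul_apply, transpose_apply]

/-- `|A|² = |Å|² + n H²`, since `Å` is orthogonal to the metric. -/
theorem IsCMC.secondFormNormSq_eq (hn : 1 ≤ n) (hH : S.IsCMC H) (x : M) :
    S.secondFormNormSq x = S.tracelessNorm x ^ 2 + n * H ^ 2 := by
  have hu := isUnit_iff_ne_zero.2 (S.det_metric_ne_zero x)
  have hg := S.sum_inv_mul_metric x
  have hh : ∑ i, ∑ j, (S.metric x)⁻¹ i j * S.secondForm x i j = n * H := by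
    have := hH x
    rw [meanCurvature] at this
    have hn0 : (n : ℝ) ≠ 0 := by positivity
    rw [← this]; field_simp
  have hs : (S.metric x)ᵀ = S.metric x := by rw [metric_eq, transpose_mul, transpose_transpose]
  rw [hH.tracelessNorm_sq, ← hH.tensorNormSq_tracelessForm, tracelessForm, hH x,
    secondFormNormSq]
  -- polarize the squared norm
  set g := S.metric x
  set h := S.secondForm x
  have hc : ∀ T : Matrix (Fin n) (Fin n) ℝ, ∀ i j,
      ∑ k, ∑ l, g⁻¹ i k * g⁻¹ j l * T i j * g k l = g⁻¹ i j * T i j := by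
    intro T i j
    have h1 : (g⁻¹ * g * (g⁻¹)ᵀ) i j = g⁻¹ i j := by
      rw [Matrix.nonsing_inv_mul _ hu, Matrix.one_mul, transpose_nonsing_inv, hs]
    rw [← h1]
    simp only [Matrix.mul_apply, transpose_apply, Finset.sum_mul]
    rw [Finset.sum_comm]
    refine Finset.sum_congr rfl fun k _ => Finset.sum_congr rfl fun l _ => ?_
    ring
  have hc' : ∀ T : Matrix (Fin n) (Fin n) ℝ, ∑ i, ∑ j, ∑ k, ∑ l, g⁻¹ i k * g⁻¹ j l * g i j * T k l
      = ∑ i, ∑ j, g⁻¹ i j * T i j := by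
    intro T
    have hgi : ∀ i j, g⁻¹ i j = g⁻¹ j i := fun i j => by
      conv_lhs => rw [← hs, ← transpose_nonsing_inv, transpose_apply]
    have swap := Finset.sum_comm (s := (Finset.univ : Finset (Fin n × Fin n)))
      (t := (Finset.univ : Finset (Fin n × Fin n)))
      (f := fun p r => g⁻¹ p.1 r.1 * g⁻¹ p.2 r.2 * g p.1 p.2 * T r.1 r.2)
    simp only [Fintype.sum_prod_type] at swap
    rw [swap]
    refine Finset.sum_congr rfl fun i _ => Finset.sum_congr rfl fun j _ => ?_
    rw [← hc T i j]
    refine Finset.sum_congr rfl fun k _ => Finset.sum_congr rfl fun l _ => ?_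
    rw [hgi k i, hgi l j]; ring
  have e : ∀ i j k l, g⁻¹ i k * g⁻¹ j l * (h - H • g) i j * (h - H • g) k l
      = g⁻¹ i k * g⁻¹ j l * h i j * h k l - H * (g⁻¹ i k * g⁻¹ j l * h i j * g k l)
        - H * (g⁻¹ i k * g⁻¹ j l * g i j * h k l)
        + H ^ 2 * (g⁻¹ i k * g⁻¹ j l * g i j * g k l) := by
    intro i j k l
    simp only [Matrix.sub_apply, Matrix.smul_apply, smul_eq_mul]; ring
  simp only [tensorNormSq]
  change _ = (∑ i, ∑ j, ∑ k, ∑ l, g⁻¹ i k * g⁻¹ j l * (h - H • g) i j * (h - H • g) k l) + _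
  simp only [e, Finset.sum_add_distrib, Finset.sum_sub_distrib, ← Finset.mul_sum, hc, hc', hg, hh]
  ring

theorem tracelessNorm_eq_zero_of_dim_one (hn : n = 1) (x : M) : S.tracelessNorm x = 0 := by
  subst hn
  have hd := S.det_metric_ne_zero x
  rw [Matrix.det_fin_one] at hd
  have hT : S.tracelessForm x = 0 := by
    ext i j
    rw [Subsingleton.elim i 0, Subsingleton.elim j 0]
    simp [tracelessForm, meanCurvature]
    field_simp
    ring
  simp [tracelessNorm, tensorNormSq, hT]

variable (S) [IsManifold (𝓡 n) ∞ M] {c : OpenPartialHomeomorph M (EuclideanSpace ℝ (Fin n))}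

theorem ambientForm_eq_chart (hc : c ∈ IsManifold.maximalAtlas (𝓡 n) ∞ M) {x : M}
    (hx : x ∈ c.source) :
    S.ambientForm H x = coframe (jacobian S.toFun c (c x))
      * (-((jacobian S.normal c (c x))ᵀ * jacobian S.toFun c (c x))
        - H • ((jacobian S.toFun c (c x))ᵀ * jacobian S.toFun c (c x)))
      * (coframe (jacobian S.toFun c (c x)))ᵀ := by
  have hc' := IsManifold.chart_mem_maximalAtlas (I := 𝓡 n) (n := ∞) x
  have hx' := mem_chart_source (EuclideanSpace ℝ (Fin n)) x
  have hP := det_transition_ne_zero hc hc' hx hx'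
  rw [ambientForm, secondForm_eq, metric_eq, jacobian_chart_change S.smooth_toFun hc hc' hx hx',
    jacobian_chart_change S.smooth_normal hc hc' hx hx']
  rw [← coframe_mul (jacobian S.toFun (chartAt _ x) (chartAt (EuclideanSpace ℝ (Fin n)) x x)) hP]
  simp only [transpose_mul, transpose_transpose, Matrix.mul_assoc, Matrix.mul_sub, Matrix.sub_mul,
    Matrix.mul_neg, Matrix.neg_mul, Matrix.mul_smul, Matrix.smul_mul]

theorem contMDiff_ambientForm_apply (a b : Fin (n + 1)) :
    ContMDiff (𝓡 n) 𝓘(ℝ, ℝ) ∞ (fun x => S.ambientForm H x a b) := by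
  refine contMDiff_of_chart (fun c y => (coframe (jacobian S.toFun c y)
      * (-((jacobian S.normal c y)ᵀ * jacobian S.toFun c y)
        - H • ((jacobian S.toFun c y)ᵀ * jacobian S.toFun c y))
      * (coframe (jacobian S.toFun c y))ᵀ) a b) ?_ ?_
  · intro c hc
    have hR := contDiffOn_coframe (contDiffOn_jacobian S.smooth_toFun hc)
      (fun y hy => S.det_gram_jacobian_ne_zero hc hy)
    refine contDiffOn_matrix_mul (contDiffOn_matrix_mul hR fun i j => ?_) (fun i j => hR j i) a b
    exact (contDiffOn_matrix_mul (fun i j => contDiffOn_jacobian S.smooth_normal hc j i)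
      (contDiffOn_jacobian S.smooth_toFun hc) i j).neg.sub
      ((contDiffOn_matrix_mul (fun i j => contDiffOn_jacobian S.smooth_toFun hc j i)
      (contDiffOn_jacobian S.smooth_toFun hc) i j).const_smul H)
  · intro c hc x hx
    rw [S.ambientForm_eq_chart hc hx]

end TracelessForm

/-! ### Compact sets have finite volume -/

section Volume
variable (S : Hypersurface n M)
  {c c' : OpenPartialHomeomorph M (EuclideanSpace ℝ (Fin n))}

theorem chartDensity_eq (c : OpenPartialHomeomorph M (EuclideanSpace ℝ (Fin n)))
    (y : EuclideanSpace ℝ (Fin n)) : S.chartDensity c y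
      = Real.sqrt ((jacobian S.toFun c y)ᵀ * jacobian S.toFun c y).det := by
  rw [chartDensity]
  congr 2
  ext i j
  simp only [Matrix.of_apply, Matrix.mul_apply, Matrix.transpose_apply, jacobian]
  rw [PiLp.inner_apply]
  exact Finset.sum_congr rfl fun a _ => by simp [mul_comm]

theorem continuousOn_chartDensity (hc : c ∈ IsManifold.maximalAtlas (𝓡 n) ∞ M) :
    ContinuousOn (S.chartDensity c) c.target := by
  have : S.chartDensity c = fun y =>
      Real.sqrt ((jacobian S.toFun c y)ᵀ * jacobian S.toFun c y).det :=
    funext (S.chartDensity_eq c)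
  rw [this]
  exact (contDiffOn_matrix_det (contDiffOn_matrix_mul
    (fun i j => contDiffOn_jacobian S.smooth_toFun hc j i)
    (contDiffOn_jacobian S.smooth_toFun hc))).continuousOn.sqrt

theorem det_fderiv_eq_det_transition {X : Type*} [TopologicalSpace X]
    (c c' : OpenPartialHomeomorph X (EuclideanSpace ℝ (Fin n)))
    (y : EuclideanSpace ℝ (Fin n)) :
    (fderiv ℝ (c' ∘ c.symm) y).det = (transition c c' y).det := by
  rw [ContinuousLinearMap.det, ← LinearMap.det_toMatrix (EuclideanSpace.basisFun (Fin n) ℝ).toBasis]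
  congr 1

theorem chartDensity_chart_change (hc : c ∈ IsManifold.maximalAtlas (𝓡 n) ∞ M)
    (hc' : c' ∈ IsManifold.maximalAtlas (𝓡 n) ∞ M) {x : M} (hx : x ∈ c.source)
    (hx' : x ∈ c'.source) :
    S.chartDensity c (c x)
      = |(fderiv ℝ (c' ∘ c.symm) (c x)).det| * S.chartDensity c' (c' x) := by
  rw [chartDensity_eq, chartDensity_eq, det_fderiv_eq_det_transition,
    jacobian_chart_change S.smooth_toFun hc hc' hx hx', ← Real.sqrt_sq_eq_abs,
    ← Real.sqrt_mul (sq_nonneg _)]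
  congr 1
  rw [transpose_mul, Matrix.mul_assoc, ← Matrix.mul_assoc _ _ (transition _ _ _), det_mul, det_mul,
    det_transpose]
  ring

variable [MeasurableSpace M] [BorelSpace M]

theorem chartVolume_apply (c : OpenPartialHomeomorph M (EuclideanSpace ℝ (Fin n))) {A : Set M}
    (hA : MeasurableSet A) : S.chartVolume c A
      = ∫⁻ y in c.target ∩ c.symm ⁻¹' A, ENNReal.ofReal (S.chartDensity c y) := by
  have hm : AEMeasurable c.symm
      ((volume.restrict c.target).withDensity fun y => ENNReal.ofReal (S.chartDensity c y)) :=
    (c.continuousOn_symm.aemeasurable c.open_target.measurableSet).mono_ac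
      (withDensity_absolutelyContinuous _ _)
  rw [chartVolume, Measure.map_apply_of_aemeasurable hm hA, withDensity_apply',
    Measure.restrict_restrict' c.open_target.measurableSet, Set.inter_comm]

theorem measurableSet_target_inter_preimage_symm {X : Type*} [TopologicalSpace X]
    [MeasurableSpace X] [BorelSpace X]
    (c : OpenPartialHomeomorph X (EuclideanSpace ℝ (Fin n))) {A : Set X} (hA : MeasurableSet A) :
    MeasurableSet (c.target ∩ c.symm ⁻¹' A) := by
  have h : Measurable fun y : c.target => c.symm y :=
    (continuousOn_iff_continuous_domRestrict.1 c.continuousOn_symm).measurable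
  have := c.open_target.measurableSet.subtype_image (h hA)
  rwa [show ((fun y : c.target => c.symm y) ⁻¹' A) = Subtype.val ⁻¹' (c.symm ⁻¹' A) from rfl,
    Subtype.image_preimage_coe] at this

/-- The volumes of two charts agree on the overlap, by the change of variables formula. -/
theorem chartVolume_eq_of_subset (hc : c ∈ IsManifold.maximalAtlas (𝓡 n) ∞ M)
    (hc' : c' ∈ IsManifold.maximalAtlas (𝓡 n) ∞ M) {A : Set M}
    (hA : MeasurableSet A) (hAc : A ⊆ c.source) (hAc' : A ⊆ c'.source) :
    S.chartVolume c A = S.chartVolume c' A := by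
  rw [chartVolume_apply _ _ hA, chartVolume_apply _ _ hA]
  set s := c.target ∩ c.symm ⁻¹' A with hs_def
  have hs : MeasurableSet s := measurableSet_target_inter_preimage_symm c hA
  have himage : (c' ∘ c.symm) '' s = c'.target ∩ c'.symm ⁻¹' A := by
    ext y
    constructor
    · rintro ⟨z, ⟨_, hz⟩, rfl⟩
      refine ⟨c'.map_source (hAc' hz), ?_⟩
      simp only [Set.mem_preimage, Function.comp_apply]
      rwa [c'.left_inv (hAc' hz)]
    · rintro ⟨hy, hyA⟩
      refine ⟨c (c'.symm y), ⟨c.map_source (hAc hyA), ?_⟩, ?_⟩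
      · simp only [Set.mem_preimage]
        rwa [c.left_inv (hAc hyA)]
      · simp only [Function.comp_apply]
        rw [c.left_inv (hAc hyA), c'.right_inv hy]
  have hinj : Set.InjOn (c' ∘ c.symm) s := fun y hy z hz h =>
    c.symm.injOn hy.1 hz.1 (c'.injOn (hAc' hy.2) (hAc' hz.2) h)
  have hderiv : ∀ y ∈ s, HasFDerivWithinAt (c' ∘ c.symm) (fderiv ℝ (c' ∘ c.symm) y) s y := by
    intro y hy
    have := hasFDerivAt_chart_comp_symm hc hc' (hAc hy.2) (hAc' hy.2)
    rw [c.right_inv hy.1] at this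
    exact this.hasFDerivWithinAt
  rw [← himage, lintegral_image_eq_lintegral_abs_det_fderiv_mul volume hs hderiv hinj]
  refine setLIntegral_congr_fun hs fun y hy => ?_
  have := S.chartDensity_chart_change hc hc' (hAc hy.2) (hAc' hy.2)
  rw [c.right_inv hy.1] at this
  simp only [this, Function.comp_apply]
  rw [ENNReal.ofReal_mul (abs_nonneg _)]

theorem chartVolume_le_of_subset (hc : c ∈ IsManifold.maximalAtlas (𝓡 n) ∞ M)
    (hc' : c' ∈ IsManifold.maximalAtlas (𝓡 n) ∞ M) {A : Set M}
    (hA : MeasurableSet A) (hAc' : A ⊆ c'.source) :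
    S.chartVolume c A ≤ S.chartVolume c' A := by
  have hm : MeasurableSet (A ∩ c.source) := hA.inter c.open_source.measurableSet
  have h : S.chartVolume c A = S.chartVolume c (A ∩ c.source) := by
    rw [chartVolume_apply _ _ hA, chartVolume_apply _ _ hm]
    congr 2
    ext y
    exact ⟨fun hy => ⟨hy.1, hy.2, c.map_target hy.1⟩, fun hy => ⟨hy.1, hy.2.1⟩⟩
  rw [h, S.chartVolume_eq_of_subset hc hc' hm Set.inter_subset_right
    (Set.inter_subset_left.trans hAc')]
  exact measure_mono Set.inter_subset_left

theorem exists_isOpen_chartVolume_lt_top (hc : c ∈ IsManifold.maximalAtlas (𝓡 n) ∞ M) {x : M}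
    (hx : x ∈ c.source) :
    ∃ U : Set M, IsOpen U ∧ x ∈ U ∧ U ⊆ c.source ∧ S.chartVolume c U < ⊤ := by
  obtain ⟨r, hr, hball⟩ := Metric.nhds_basis_closedBall.mem_iff.1
    (c.open_target.mem_nhds (c.map_source hx))
  obtain ⟨C, hC⟩ := (isCompact_closedBall (c x) r).exists_bound_of_continuousOn
    ((S.continuousOn_chartDensity hc).mono hball)
  have hU : IsOpen (c.source ∩ c ⁻¹' Metric.ball (c x) r) :=
    c.isOpen_inter_preimage Metric.isOpen_ball
  refine ⟨_, hU, ⟨hx, Metric.mem_ball_self hr⟩, Set.inter_subset_left, ?_⟩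
  rw [chartVolume_apply _ _ hU.measurableSet]
  have hsub : c.target ∩ c.symm ⁻¹' (c.source ∩ c ⁻¹' Metric.ball (c x) r)
      ⊆ Metric.closedBall (c x) r := by
    rintro y ⟨hy, hy'⟩
    have := hy'.2
    rw [Set.mem_preimage, c.right_inv hy] at this
    exact Metric.ball_subset_closedBall this
  calc _ ≤ ∫⁻ y in Metric.closedBall (c x) r, ENNReal.ofReal (S.chartDensity c y) :=
        lintegral_mono_set hsub
    _ ≤ ∫⁻ _ in Metric.closedBall (c x) r, ENNReal.ofReal C :=
        setLIntegral_mono' Metric.isClosed_closedBall.measurableSet fun y hy =>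
          ENNReal.ofReal_le_ofReal ((Real.le_norm_self _).trans (hC y hy))
    _ < ⊤ := by
        rw [setLIntegral_const]
        exact ENNReal.mul_lt_top ENNReal.ofReal_lt_top measure_closedBall_lt_top

/-- If `W` is the union of finitely many small chart domains `U x` covering `K`, the supremum `vol`
is at most `∑ x, chartVolume (chartAt x)|_{U x} + ⊤|_{Wᶜ}`, and this measure is finite on `K`. -/
theorem vol_lt_top_of_isCompact [IsManifold (𝓡 n) ∞ M] {K : Set M} (hK : IsCompact K) :
    S.vol K < ⊤ := by
  have hmax := fun x : M => IsManifold.chart_mem_maximalAtlas (I := 𝓡 n) (n := ∞) x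
  choose U hUo hxU hUs hUfin using fun x : M =>
    S.exists_isOpen_chartVolume_lt_top (hmax x) (mem_chart_source (EuclideanSpace ℝ (Fin n)) x)
  obtain ⟨t, -, ht⟩ := hK.elim_nhds_subcover U fun x _ => (hUo x).mem_nhds (hxU x)
  set W : Set M := ⋃ x ∈ t, U x
  have hW : MeasurableSet W := (isOpen_biUnion fun x _ => hUo x).measurableSet
  have hle : S.vol ≤ (∑ x ∈ t, (S.chartVolume (chartAt _ x)).restrict (U x))
      + (⊤ : Measure M).restrict Wᶜ := by
    refine iSup_le fun z => Measure.le_iff.2 fun A hA => ?_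
    have hcover : A ⊆ (⋃ x ∈ t, A ∩ U x) ∪ (A ∩ Wᶜ) := by
      intro a ha
      by_cases haW : a ∈ W
      · obtain ⟨x, hx, hax⟩ := Set.mem_iUnion₂.1 haW
        exact Or.inl (Set.mem_iUnion₂.2 ⟨x, hx, ha, hax⟩)
      · exact Or.inr ⟨ha, haW⟩
    rw [Measure.add_apply, Measure.finsetSum_apply, Measure.restrict_apply hA]
    refine (measure_mono hcover).trans ((measure_union_le _ _).trans (add_le_add ?_ ?_))
    · refine (measure_biUnion_finset_le _ _).trans (Finset.sum_le_sum fun x _ => ?_)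
      rw [Measure.restrict_apply hA]
      exact S.chartVolume_le_of_subset (hmax z) (hmax x) (hA.inter (hUo x).measurableSet)
        (Set.inter_subset_right.trans (hUs x))
    · exact (le_top : S.chartVolume (chartAt _ z) ≤ ⊤) _
  refine (hle K).trans_lt ?_
  have hKW : (⊤ : Measure M).restrict Wᶜ K = 0 := by
    refine measure_mono_null ht ?_
    rw [Measure.restrict_apply hW]
    simp
  rw [Measure.add_apply, Measure.finsetSum_apply, hKW, add_zero]
  refine ENNReal.sum_lt_top.2 fun x _ => ?_
  exact (measure_mono (Set.subset_univ K)).trans_lt (by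
    rw [Measure.restrict_apply_univ]; exact hUfin x)

end Volume

/-! ### Pointwise gradient bounds -/

section Pointwise
variable {S : Hypersurface n M} {H : ℝ}

theorem tracelessNorm_nonneg (x : M) : 0 ≤ S.tracelessNorm x := Real.sqrt_nonneg _

theorem gradNorm_nonneg (f : M → ℝ) (x : M) : 0 ≤ S.gradNorm f x := Real.sqrt_nonneg _

/-- The smooth approximation `(u² f² + δ)^{(1+q)/2} - δ^{(1+q)/2}` of `(u f)^{1+q}`, for `δ > 0`.
The constant is subtracted to keep the support inside that of `f`. -/
def stabilityTest (S : Hypersurface n M) (q : ℝ) (f : M → ℝ) (δ : ℝ) (x : M) : ℝ :=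
  (S.tracelessNorm x ^ 2 * (f x * f x) + δ) ^ ((1 + q) / 2) - δ ^ ((1 + q) / 2)

theorem stabilityTest_eq_zero {q δ : ℝ} {f : M → ℝ} {x : M} (hx : f x = 0) :
    S.stabilityTest q f δ x = 0 := by
  simp [stabilityTest, hx]

variable [IsManifold (𝓡 n) ∞ M]

theorem IsCMC.contMDiff_tracelessNorm_sq (hH : S.IsCMC H) :
    ContMDiff (𝓡 n) 𝓘(ℝ, ℝ) ∞ (fun x => S.tracelessNorm x ^ 2) := by
  simp only [hH.tracelessNorm_sq]
  exact contMDiff_finsetSum fun p _ => (S.contMDiff_ambientForm_apply p.1 p.2).pow 2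

theorem IsCMC.continuous_tracelessNorm (hH : S.IsCMC H) : Continuous S.tracelessNorm := by
  have := hH.contMDiff_tracelessNorm_sq.continuous.sqrt
  simpa only [Real.sqrt_sq (tracelessNorm_nonneg _)] using this

/-- The function `u²` is the sum of the squares of the entries `E` of the ambient form, so
`∇u² = ∑ 2 E ∇E` with `|E| ≤ u`.  This replaces a bound on `∇u`, which need not exist at the zeros
of `u`. -/
theorem IsCMC.exists_norm_gradVec_tracelessNorm_sq_le (hH : S.IsCMC H) :
    ∃ K : M → ℝ, Continuous K ∧
      ∀ x, ‖S.gradVec (fun y => S.tracelessNorm y ^ 2) x‖ ≤ 2 * S.tracelessNorm x * K x := by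
  set E : Fin (n + 1) × Fin (n + 1) → M → ℝ := fun p x => S.ambientForm H x p.1 p.2
  have hE : ∀ p, ContMDiff (𝓡 n) 𝓘(ℝ, ℝ) ∞ (E p) := fun p =>
    S.contMDiff_ambientForm_apply p.1 p.2
  refine ⟨fun x => ∑ p, ‖S.gradVec (E p) x‖,
    continuous_finsetSum _ fun p _ => (S.continuous_gradVec (hE p)).norm, fun x => ?_⟩
  simp only [hH.tracelessNorm_sq]
  rw [S.gradVec_sum_sq hE x, Finset.mul_sum]
  refine (norm_sum_le _ _).trans (Finset.sum_le_sum fun p _ => ?_)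
  rw [norm_smul, Real.norm_eq_abs, abs_mul, abs_two]
  gcongr
  refine abs_le_of_sq_le_sq ?_ (tracelessNorm_nonneg x)
  rw [hH.tracelessNorm_sq]
  exact Finset.single_le_sum (f := fun p => E p x ^ 2) (fun p _ => sq_nonneg _)
    (Finset.mem_univ p)

theorem IsCMC.norm_gradVec_tracelessNorm_sq (hH : S.IsCMC H) {x : M}
    (hx : S.tracelessNorm x ≠ 0) :
    ‖S.gradVec (fun y => S.tracelessNorm y ^ 2) x‖
      = 2 * S.tracelessNorm x * S.gradNorm S.tracelessNorm x := by
  have hd := (hH.contMDiff_tracelessNorm_sq x).mdifferentiableAt (by simp)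
  have h := S.gradVec_comp hd (Real.hasDerivAt_sqrt (pow_ne_zero 2 hx))
  simp only [Real.sqrt_sq (tracelessNorm_nonneg _)] at h
  rw [gradNorm_eq_norm_gradVec]
  change S.gradVec S.tracelessNorm x = _ at h
  have hpos := (tracelessNorm_nonneg (S := S) x).lt_of_ne' hx
  rw [h, norm_smul, Real.norm_of_nonneg (by positivity)]
  field_simp

theorem IsCMC.gradVec_tracelessNorm_sq_eq_zero (hH : S.IsCMC H) {x : M}
    (hx : S.tracelessNorm x = 0) : S.gradVec (fun y => S.tracelessNorm y ^ 2) x = 0 := by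
  obtain ⟨K, -, hK⟩ := hH.exists_norm_gradVec_tracelessNorm_sq_le
  have := hK x
  rw [hx, mul_zero, zero_mul] at this
  exact norm_le_zero_iff.1 this

theorem IsCMC.contMDiff_stabilityTest (hH : S.IsCMC H) {q δ : ℝ} (hδ : 0 < δ) {f : M → ℝ}
    (hf : ContMDiff (𝓡 n) 𝓘(ℝ, ℝ) ∞ f) :
    ContMDiff (𝓡 n) 𝓘(ℝ, ℝ) ∞ (S.stabilityTest q f δ) := by
  have hψ := (hH.contMDiff_tracelessNorm_sq.mul (hf.mul hf)).add
    (contMDiff_const (c := δ) (I := 𝓡 n) (I' := 𝓘(ℝ, ℝ)))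
  refine ContMDiff.sub (fun x => ?_) contMDiff_const
  refine ContDiffAt.comp_contMDiffAt
    (Real.contDiffAt_rpow_const_of_ne (p := (1 + q) / 2) ?_) (hψ x)
  have : 0 ≤ S.tracelessNorm x ^ 2 * (f x * f x) := mul_nonneg (sq_nonneg _) (mul_self_nonneg _)
  exact (add_pos_of_nonneg_of_pos this hδ).ne'

theorem IsCMC.gradVec_stabilityTest (hH : S.IsCMC H) {q δ : ℝ} (hδ : 0 < δ) {f : M → ℝ}
    (hf : ContMDiff (𝓡 n) 𝓘(ℝ, ℝ) ∞ f) (x : M) :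
    S.gradVec (S.stabilityTest q f δ) x
      = ((1 + q) / 2 * (S.tracelessNorm x ^ 2 * (f x * f x) + δ) ^ ((1 + q) / 2 - 1)) •
        (S.tracelessNorm x ^ 2 • ((2 * f x) • S.gradVec f x)
          + (f x * f x) • S.gradVec (fun y => S.tracelessNorm y ^ 2) x) := by
  have hdw := (hH.contMDiff_tracelessNorm_sq x).mdifferentiableAt (by simp)
  have hdf := (hf x).mdifferentiableAt (by simp)
  have hdff := ((hf.mul hf) x).mdifferentiableAt (by simp)
  have hdψ := ((hH.contMDiff_tracelessNorm_sq.mul (hf.mul hf)) x).mdifferentiableAt (by simp)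
  have hψ : 0 ≤ S.tracelessNorm x ^ 2 * (f x * f x) :=
    mul_nonneg (sq_nonneg _) (mul_self_nonneg _)
  have hφ : HasDerivAt (fun t : ℝ => (t + δ) ^ ((1 + q) / 2) - δ ^ ((1 + q) / 2))
      ((1 + q) / 2 * (S.tracelessNorm x ^ 2 * (f x * f x) + δ) ^ ((1 + q) / 2 - 1))
      (S.tracelessNorm x ^ 2 * (f x * f x)) := by
    have := (((hasDerivAt_id (S.tracelessNorm x ^ 2 * (f x * f x))).add_const δ).rpow_const
      (p := (1 + q) / 2) (Or.inl (add_pos_of_nonneg_of_pos hψ hδ).ne')).sub_const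
      (δ ^ ((1 + q) / 2))
    simpa using this
  have h1 := S.gradVec_comp hdψ hφ
  have h2 := S.gradVec_mul hdw hdff
  have h3 := S.gradVec_mul hdf hdf
  refine h1.trans ?_
  congr 1
  refine h2.trans ?_
  congr 2
  refine h3.trans ?_
  rw [← add_smul, ← two_mul]

/-- The bound for the limit `(u f)^{1+q}` holds for the approximations too: `q ≤ 1` gives
`(u² f² + δ)^{q-1} ≤ (u f)^{2q-2}`. -/
theorem IsCMC.gradNorm_stabilityTest_sq_le (hH : S.IsCMC H) {q δ : ℝ} (hq0 : 0 < q) (hq1 : q ≤ 1)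
    (hδ : 0 < δ) {f : M → ℝ} (hf : IsCutoff n f) (x : M) :
    S.gradNorm (S.stabilityTest q f δ) x ^ 2
      ≤ 2 * (1 + q) ^ 2 * (S.tracelessNorm x ^ (2 * q) * f x ^ (2 + 2 * q)
          * S.gradNorm S.tracelessNorm x ^ 2
        + S.tracelessNorm x ^ (2 + 2 * q) * f x ^ (2 * q) * S.gradNorm f x ^ 2) := by
  have hu := tracelessNorm_nonneg (S := S) x
  have hf0 := (hf.2.2 x).1
  rw [gradNorm_eq_norm_gradVec, hH.gradVec_stabilityTest hδ hf.1]
  rcases hu.eq_or_lt' with hu0 | hu0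
  · rw [hH.gradVec_tracelessNorm_sq_eq_zero hu0, hu0]
    simp only [ne_eq, OfNat.ofNat_ne_zero, not_false_eq_true, zero_pow, zero_smul, smul_zero,
      add_zero, norm_zero]
    positivity
  rcases hf0.eq_or_lt' with hf0' | hf0'
  · rw [hf0']
    simp only [mul_zero, zero_smul, smul_zero, add_zero, norm_zero, ne_eq, OfNat.ofNat_ne_zero,
      not_false_eq_true, zero_pow]
    positivity
  have hw := hH.norm_gradVec_tracelessNorm_sq hu0.ne'
  set u := S.tracelessNorm x
  set t := f x
  set P := S.gradVec f x
  set Q := S.gradVec (fun y => S.tracelessNorm y ^ 2) x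
  have hgf : S.gradNorm f x = ‖P‖ := S.gradNorm_eq_norm_gradVec f x
  set U := S.gradNorm S.tracelessNorm x
  have hU : 0 ≤ U := gradNorm_nonneg _ _
  rw [hgf]
  have hψ : 0 < u ^ 2 * (t * t) := by positivity
  have hnorm : ‖u ^ 2 • ((2 * t) • P) + (t * t) • Q‖ ≤ 2 * u * t * (u * ‖P‖ + t * U) := by
    refine (norm_add_le _ _).trans (le_of_eq ?_)
    rw [norm_smul, norm_smul, norm_smul, hw, Real.norm_of_nonneg (by positivity),
      Real.norm_of_nonneg (by positivity), Real.norm_of_nonneg (by positivity)]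
    ring
  have hpow : ((u ^ 2 * (t * t) + δ) ^ ((1 + q) / 2 - 1)) ^ 2
      ≤ u ^ (2 * q - 2) * t ^ (2 * q - 2) := by
    rw [← Real.rpow_natCast, ← Real.rpow_mul (by positivity)]
    have e : ((1 + q) / 2 - 1) * ((2 : ℕ) : ℝ) = q - 1 := by push_cast; ring
    rw [e]
    refine (Real.rpow_le_rpow_of_nonpos hψ (le_add_of_nonneg_right hδ.le) (by linarith)).trans ?_
    have e1 : u ^ (2 * q - 2) = (u ^ 2) ^ (q - 1) := by
      rw [← Real.rpow_natCast, ← Real.rpow_mul hu]; congr 1; push_cast; ring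
    have e2 : t ^ (2 * q - 2) = (t * t) ^ (q - 1) := by
      rw [← sq, ← Real.rpow_natCast, ← Real.rpow_mul hf0]; congr 1; push_cast; ring
    rw [e1, e2, Real.mul_rpow (by positivity) (by positivity)]
  have hu2 : u ^ (2 * q) = u ^ (2 * q - 2) * u ^ 2 := by
    rw [← Real.rpow_natCast u 2, ← Real.rpow_add hu0]; congr 1; push_cast; ring
  have hu4 : u ^ (2 + 2 * q) = u ^ (2 * q - 2) * u ^ 4 := by
    rw [← Real.rpow_natCast u 4, ← Real.rpow_add hu0]; congr 1; push_cast; ring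
  have ht2 : t ^ (2 * q) = t ^ (2 * q - 2) * t ^ 2 := by
    rw [← Real.rpow_natCast t 2, ← Real.rpow_add hf0']; congr 1; push_cast; ring
  have ht4 : t ^ (2 + 2 * q) = t ^ (2 * q - 2) * t ^ 4 := by
    rw [← Real.rpow_natCast t 4, ← Real.rpow_add hf0']; congr 1; push_cast; ring
  have hu' : 0 ≤ u ^ (2 * q - 2) := by positivity
  have ht' : 0 ≤ t ^ (2 * q - 2) := by positivity
  rw [hu2, hu4, ht2, ht4, norm_smul, mul_pow, Real.norm_eq_abs, sq_abs, mul_pow]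
  calc ((1 + q) / 2) ^ 2 * ((u ^ 2 * (t * t) + δ) ^ ((1 + q) / 2 - 1)) ^ 2
        * ‖u ^ 2 • ((2 * t) • P) + (t * t) • Q‖ ^ 2
      ≤ ((1 + q) / 2) ^ 2 * (u ^ (2 * q - 2) * t ^ (2 * q - 2))
        * (2 * u * t * (u * ‖P‖ + t * U)) ^ 2 := by gcongr
    _ = (1 + q) ^ 2 * (u ^ (2 * q - 2) * t ^ (2 * q - 2)) * (u * t) ^ 2
        * (u * ‖P‖ + t * U) ^ 2 := by ring
    _ ≤ (1 + q) ^ 2 * (u ^ (2 * q - 2) * t ^ (2 * q - 2)) * (u * t) ^ 2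
        * (2 * ((u * ‖P‖) ^ 2 + (t * U) ^ 2)) := by
        gcongr
        nlinarith [sq_nonneg (u * ‖P‖ - t * U)]
    _ = _ := by ring

end Pointwise

/-! ### Integrability and the stability inequality for `(u f)^{1+q}` -/

section Integration
theorem gradNorm_eq_zero_of_notMem_tsupport (S : Hypersurface n M) {f : M → ℝ} {x : M}
    (hx : x ∉ tsupport f) : S.gradNorm f x = 0 := by
  rw [gradNorm_eq_norm_gradVec,
    S.gradVec_eq_zero_of_eventuallyEq (notMem_tsupport_iff_eventuallyEq.1 hx), norm_zero]

theorem continuous_gradNorm [IsManifold (𝓡 n) ∞ M] (S : Hypersurface n M) {f : M → ℝ}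
    (hf : ContMDiff (𝓡 n) 𝓘(ℝ, ℝ) ∞ f) : Continuous (S.gradNorm f) := by
  rw [show S.gradNorm f = fun x => ‖S.gradVec f x‖ from funext (S.gradNorm_eq_norm_gradVec f)]
  exact (S.continuous_gradVec hf).norm

variable {S : Hypersurface n M} {H : ℝ} [T2Space M] [IsManifold (𝓡 n) ∞ M] [MeasurableSpace M]
  [BorelSpace M]

theorem integrable_vol_of_bound (S : Hypersurface n M) {g h : M → ℝ} {K : Set M}
    (hK : IsCompact K) (hg : Measurable g) (hh : Continuous h) (hle : ∀ x, |g x| ≤ h x)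
    (h0 : ∀ x ∉ K, g x = 0) : Integrable g S.vol := by
  obtain ⟨C, hC⟩ := hK.exists_bound_of_continuousOn hh.continuousOn
  refine (integrableOn_iff_integrable_of_support_subset (s := K) fun x hx => ?_).1 ?_
  · by_contra hxK
    exact hx (h0 x hxK)
  · refine Measure.integrableOn_of_bounded (M := C) (S.vol_lt_top_of_isCompact hK).ne
      hg.aestronglyMeasurable ?_
    exact ae_restrict_of_forall_mem hK.measurableSet fun x hx => (hle x).trans
      ((le_abs_self _).trans (hC x hx))

theorem integrable_vol_of_continuous (S : Hypersurface n M) {g : M → ℝ} {K : Set M}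
    (hK : IsCompact K) (hg : Continuous g) (h0 : ∀ x ∉ K, g x = 0) : Integrable g S.vol :=
  S.integrable_vol_of_bound hK hg.measurable hg.abs (fun _ => le_rfl) h0

theorem IsCMC.integrable_gradient_term (hH : S.IsCMC H) {q : ℝ} (hq : 0 < q) {f : M → ℝ}
    (hf : IsCutoff n f) :
    Integrable (fun x => S.tracelessNorm x ^ (2 * q) * f x ^ (2 + 2 * q)
      * S.gradNorm S.tracelessNorm x ^ 2) S.vol := by
  obtain ⟨K, hK, hKle⟩ := hH.exists_norm_gradVec_tracelessNorm_sq_le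
  have hu := hH.continuous_tracelessNorm
  have hfc := hf.1.continuous
  have e : (fun x => S.tracelessNorm x ^ (2 * q) * f x ^ (2 + 2 * q)
      * S.gradNorm S.tracelessNorm x ^ 2) = fun x => S.tracelessNorm x ^ (2 * q)
        * f x ^ (2 + 2 * q) * (‖S.gradVec (fun y => S.tracelessNorm y ^ 2) x‖ ^ 2
          / (2 * S.tracelessNorm x) ^ 2) := by
    -- at the zeros of `u` both sides vanish because of the factor `u^{2q}`, whatever `∇u` is there
    ext x
    by_cases hx : S.tracelessNorm x = 0
    · rw [hx, Real.zero_rpow (by positivity)]; simp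
    · rw [hH.norm_gradVec_tracelessNorm_sq hx]
      field_simp
  rw [e]
  refine S.integrable_vol_of_bound (h := fun x => S.tracelessNorm x ^ (2 * q)
    * f x ^ (2 + 2 * q) * K x ^ 2) hf.2.1 ?_ ?_ ?_ ?_
  · have := (S.continuous_gradVec hH.contMDiff_tracelessNorm_sq).norm.measurable
    exact ((hu.measurable.pow_const _).mul (hfc.measurable.pow_const _)).mul
      ((this.pow_const 2).div ((hu.measurable.const_mul 2).pow_const 2))
  · exact ((hu.rpow_const fun _ => Or.inr (by positivity)).mul
      (hfc.rpow_const fun _ => Or.inr (by positivity))).mul (hK.pow 2)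
  · intro x
    have hf0 := (hf.2.2 x).1
    have hu0 := tracelessNorm_nonneg (S := S) x
    rw [abs_of_nonneg (by positivity)]
    gcongr
    by_cases hx : S.tracelessNorm x = 0
    · rw [hx]; simp [sq_nonneg]
    · have := hu0.lt_of_ne' hx
      rw [div_le_iff₀ (by positivity), ← mul_pow, mul_comm (K x)]
      gcongr
      exact hKle x
  · intro x hx
    rw [image_eq_zero_of_notMem_tsupport hx, Real.zero_rpow (by positivity)]; simp

theorem IsCMC.integrable_rpow_mul_rpow (hH : S.IsCMC H) {a b : ℝ} (ha : 0 < a) (hb : 0 < b)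
    {f : M → ℝ} (hf : IsCutoff n f) :
    Integrable (fun x => S.tracelessNorm x ^ a * f x ^ b) S.vol := by
  refine S.integrable_vol_of_continuous hf.2.1
    ((hH.continuous_tracelessNorm.rpow_const fun _ => Or.inr ha.le).mul
      (hf.1.continuous.rpow_const fun _ => Or.inr hb.le)) fun x hx => ?_
  rw [image_eq_zero_of_notMem_tsupport hx, Real.zero_rpow hb.ne', mul_zero]

theorem IsCMC.integrable_cutoff_gradient_term (hH : S.IsCMC H) {q : ℝ} (hq : 0 < q) {f : M → ℝ}
    (hf : IsCutoff n f) :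
    Integrable (fun x => S.tracelessNorm x ^ (2 + 2 * q) * f x ^ (2 * q) * S.gradNorm f x ^ 2)
      S.vol := by
  refine S.integrable_vol_of_continuous hf.2.1
    (((hH.continuous_tracelessNorm.rpow_const fun _ => Or.inr (by positivity)).mul
      (hf.1.continuous.rpow_const fun _ => Or.inr (by positivity))).mul
      ((S.continuous_gradNorm hf.1).pow 2)) fun x hx => ?_
  rw [S.gradNorm_eq_zero_of_notMem_tsupport hx]; simp

/-- The stability inequality for the test function `(u f)^{1+q}`, with the square in `|∇φ|²`
expanded by `(x + y)² ≤ 2 (x² + y²)`. -/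
theorem IsCMC.stability_rpow (hn : 1 ≤ n) (hH : S.IsCMC H) (hS : S.StronglyStable) {q : ℝ}
    (hq : 0 < q) (hq1 : q ≤ 1) {f : M → ℝ} (hf : IsCutoff n f) :
    ∫ x, (S.tracelessNorm x ^ 2 + n * H ^ 2)
        * (S.tracelessNorm x ^ (2 + 2 * q) * f x ^ (2 + 2 * q)) ∂S.vol
      ≤ 2 * (1 + q) ^ 2 * (∫ x, S.tracelessNorm x ^ (2 * q) * f x ^ (2 + 2 * q)
          * S.gradNorm S.tracelessNorm x ^ 2 ∂S.vol
        + ∫ x, S.tracelessNorm x ^ (2 + 2 * q) * f x ^ (2 * q) * S.gradNorm f x ^ 2 ∂S.vol) := by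
  have hu := hH.continuous_tracelessNorm
  have hfc := hf.1.continuous
  have hψc : Continuous fun x => S.tracelessNorm x ^ 2 * (f x * f x) :=
    (hu.pow 2).mul (hfc.mul hfc)
  have hψ0 : ∀ x, 0 ≤ S.tracelessNorm x ^ 2 * (f x * f x) := fun x =>
    mul_nonneg (sq_nonneg _) (mul_self_nonneg _)
  have hs : 0 < (1 + q) / 2 := by positivity
  set δ : ℕ → ℝ := fun k => 1 / ((k : ℝ) + 1)
  have hδ : ∀ k, 0 < δ k := fun k => by positivity
  have hδ1 : ∀ k, δ k ≤ 1 := fun k => by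
    simp only [δ]; rw [div_le_one (by positivity)]; linarith [(Nat.cast_nonneg k : (0 : ℝ) ≤ k)]
  have hδlim : Filter.Tendsto δ Filter.atTop (nhds 0) := tendsto_one_div_add_atTop_nhds_zero_nat
  have hI1 := hH.integrable_gradient_term hq hf
  have hI2 := hH.integrable_cutoff_gradient_term hq hf
  have hA : ∀ x, 0 ≤ S.tracelessNorm x ^ 2 + n * H ^ 2 := fun x => by positivity
  have hle : ∀ k, ∫ x, (S.tracelessNorm x ^ 2 + n * H ^ 2)
      * S.stabilityTest q f (δ k) x ^ 2 ∂S.vol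
      ≤ 2 * (1 + q) ^ 2 * (∫ x, S.tracelessNorm x ^ (2 * q) * f x ^ (2 + 2 * q)
          * S.gradNorm S.tracelessNorm x ^ 2 ∂S.vol
        + ∫ x, S.tracelessNorm x ^ (2 + 2 * q) * f x ^ (2 * q) * S.gradNorm f x ^ 2 ∂S.vol) := by
    intro k
    have hsupp : HasCompactSupport (S.stabilityTest q f (δ k)) :=
      hf.2.1.mono fun x hx hfx => hx (stabilityTest_eq_zero hfx)
    have h1 := hS _ (hH.contMDiff_stabilityTest (q := q) (hδ k) hf.1) hsupp
    simp only [hH.secondFormNormSq_eq hn] at h1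
    refine h1.trans ?_
    rw [← integral_add hI1 hI2, ← integral_const_mul]
    exact integral_mono_of_nonneg (Filter.Eventually.of_forall fun x => sq_nonneg _)
      ((hI1.add hI2).const_mul _)
      (Filter.Eventually.of_forall fun x => hH.gradNorm_stabilityTest_sq_le hq hq1 (hδ k) hf x)
  have hmono : ∀ k x, 0 ≤ S.stabilityTest q f (δ k) x := fun k x =>
    sub_nonneg.2 (Real.rpow_le_rpow (hδ k).le (le_add_of_nonneg_left (hψ0 x)) hs.le)
  have hbound : ∀ k x, S.stabilityTest q f (δ k) x
      ≤ (S.tracelessNorm x ^ 2 * (f x * f x) + 1) ^ ((1 + q) / 2) := fun k x =>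
    (sub_le_self _ (Real.rpow_nonneg (hδ k).le _)).trans
      (Real.rpow_le_rpow (add_nonneg (hψ0 x) (hδ k).le) (by linarith [hδ1 k]) hs.le)
  have hBc : Continuous fun x => (S.tracelessNorm x ^ 2 + n * H ^ 2)
      * ((S.tracelessNorm x ^ 2 * (f x * f x) + 1) ^ ((1 + q) / 2)) ^ 2 :=
    ((hu.pow 2).add continuous_const).mul
      (((hψc.add continuous_const).rpow_const fun _ => Or.inr hs.le).pow 2)
  have hB0 : ∀ x, 0 ≤ (S.tracelessNorm x ^ 2 + n * H ^ 2)
      * ((S.tracelessNorm x ^ 2 * (f x * f x) + 1) ^ ((1 + q) / 2)) ^ 2 := fun x =>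
    mul_nonneg (hA x) (sq_nonneg _)
  have hlim := tendsto_integral_of_dominated_convergence (μ := S.vol)
    (F := fun k x => (S.tracelessNorm x ^ 2 + n * H ^ 2) * S.stabilityTest q f (δ k) x ^ 2)
    (f := fun x => (S.tracelessNorm x ^ 2 + n * H ^ 2)
        * (S.tracelessNorm x ^ (2 + 2 * q) * f x ^ (2 + 2 * q)))
    ((tsupport f).indicator fun x => (S.tracelessNorm x ^ 2 + n * H ^ 2)
      * ((S.tracelessNorm x ^ 2 * (f x * f x) + 1) ^ ((1 + q) / 2)) ^ 2) ?_ ?_ ?_ ?_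
  · exact le_of_tendsto' hlim hle
  · intro k
    exact (((hu.pow 2).add continuous_const).mul
      ((hH.contMDiff_stabilityTest (q := q) (hδ k) hf.1).continuous.pow 2)).aestronglyMeasurable
  · refine S.integrable_vol_of_bound hf.2.1
      (hBc.measurable.indicator (isClosed_tsupport f).measurableSet) hBc (fun x => ?_)
      fun x hx => Set.indicator_of_notMem hx _
    rw [abs_of_nonneg (Set.indicator_nonneg (fun y _ => hB0 y) x)]
    exact Set.indicator_le_self' (fun y _ => hB0 y) x
  · refine fun k => Filter.Eventually.of_forall fun x => ?_
    by_cases hx : x ∈ tsupport f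
    · rw [Set.indicator_of_mem hx, Real.norm_of_nonneg (mul_nonneg (hA x) (sq_nonneg _))]
      have := hA x
      gcongr
      · exact hmono k x
      · exact hbound k x
    · rw [Set.indicator_of_notMem hx, stabilityTest_eq_zero (image_eq_zero_of_notMem_tsupport hx)]
      simp
  · refine Filter.Eventually.of_forall fun x => ?_
    have hfin : S.tracelessNorm x ^ (2 + 2 * q) * f x ^ (2 + 2 * q)
        = ((S.tracelessNorm x ^ 2 * (f x * f x) + 0) ^ ((1 + q) / 2) - 0 ^ ((1 + q) / 2)) ^ 2 := by
      have hu0 := tracelessNorm_nonneg (S := S) x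
      have hf0 := (hf.2.2 x).1
      rw [Real.zero_rpow hs.ne', sub_zero, add_zero, ← sq, ← mul_pow, ← Real.rpow_natCast (_ ^ _) 2,
        ← Real.rpow_mul (by positivity), ← Real.rpow_natCast _ 2, ← Real.rpow_mul (by positivity),
        ← Real.mul_rpow hu0 hf0]
      congr 1; push_cast; ring
    rw [hfin]
    refine (Filter.Tendsto.pow (Filter.Tendsto.sub ?_ ?_) 2).const_mul _
    · exact ((tendsto_const_nhds.add hδlim).rpow_const (Or.inr hs.le))
    · exact hδlim.rpow_const (Or.inr hs.le)

end Integration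

end Hypersurface

end

/-! ### The conditional Hölder closure -/

theorem proposition3p3 {n : ℕ} (hn : 1 ≤ n) {M : Type*} [TopologicalSpace M] [T2Space M]
    [SecondCountableTopology M] [ChartedSpace (EuclideanSpace ℝ (Fin n)) M]
    [IsManifold (𝓡 n) ∞ M] [MeasurableSpace M] [BorelSpace M]
    (S : Hypersurface n M) (H : ℝ) (hH : S.IsCMC H) (hS : S.StronglyStable)
    (q : ℝ) (hq0 : 0 < q) (hq : q < Real.sqrt (2 / (n : ℝ)))
    (C₀ B₀ : ℝ) (hC₀ : 0 < C₀) (hB₀ : 0 ≤ B₀) (hgrad : S.GradientEstimate H q C₀ B₀)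
    (f : M → ℝ) (hf : Hypersurface.IsCutoff n f) :
    ∫ x, S.tracelessNorm x ^ (4 + 2 * q) * f x ^ (2 + 2 * q) ∂S.vol
      ≤ (2 : ℝ) ^ q * (2 * (1 + q) ^ 2 * (C₀ + 1)) ^ (1 + q)
          * ∫ x, S.tracelessNorm x ^ 2 * S.gradNorm f x ^ (2 + 2 * q) ∂S.vol
        + (2 : ℝ) ^ q * (max 0 (2 * (1 + q) ^ 2 * B₀ - (n : ℝ))) ^ (1 + q)
          * |H| ^ (2 + 2 * q)
          * ∫ x, S.tracelessNorm x ^ 2 * f x ^ (2 + 2 * q) ∂S.vol := by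
  have hu0 := fun x => Hypersurface.tracelessNorm_nonneg (S := S) x
  have hf0 := fun x => (hf.2.2 x).1
  have hg0 := fun x => Hypersurface.gradNorm_nonneg (S := S) f x
  have hG0 : ∀ x, 0 ≤ S.tracelessNorm x ^ 2 * S.gradNorm f x ^ (2 + 2 * q) := fun x =>
    mul_nonneg (sq_nonneg _) (Real.rpow_nonneg (hg0 x) _)
  have hE0 : ∀ x, 0 ≤ S.tracelessNorm x ^ 2 * f x ^ (2 + 2 * q) := fun x =>
    mul_nonneg (sq_nonneg _) (Real.rpow_nonneg (hf0 x) _)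
  have hL0 : ∀ x, 0 ≤ S.tracelessNorm x ^ (4 + 2 * q) * f x ^ (2 + 2 * q) := fun x =>
    mul_nonneg (Real.rpow_nonneg (hu0 x) _) (Real.rpow_nonneg (hf0 x) _)
  have hGi : 0 ≤ ∫ x, S.tracelessNorm x ^ 2 * S.gradNorm f x ^ (2 + 2 * q) ∂S.vol :=
    integral_nonneg hG0
  have hEi : 0 ≤ ∫ x, S.tracelessNorm x ^ 2 * f x ^ (2 + 2 * q) ∂S.vol := integral_nonneg hE0
  have hb : 0 ≤ max 0 (2 * (1 + q) ^ 2 * B₀ - (n : ℝ)) := le_max_left _ _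
  have ha : 0 ≤ 2 * (1 + q) ^ 2 * (C₀ + 1) := by positivity
  rcases le_or_gt q 1 with hq1 | hq1
  swap
  · -- `q > 1` forces `n = 1`, where every hypersurface is umbilic
    have hn1 : n = 1 := by
      by_contra hne
      have h2 : (2 : ℝ) ≤ n := by exact_mod_cast (by omega : 2 ≤ n)
      have : Real.sqrt (2 / (n : ℝ)) ≤ 1 := by
        exact Real.sqrt_le_one.2 ((div_le_one (by positivity)).2 h2)
      linarith
    have hz : ∀ x, S.tracelessNorm x = 0 := fun x => S.tracelessNorm_eq_zero_of_dim_one hn1 x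
    have : ∀ x, S.tracelessNorm x ^ (4 + 2 * q) * f x ^ (2 + 2 * q) = 0 := fun x => by
      rw [hz, Real.zero_rpow (by positivity), zero_mul]
    simp only [this, integral_zero]
    positivity
  have hLint := hH.integrable_rpow_mul_rpow (a := 4 + 2 * q) (b := 2 + 2 * q)
    (by positivity) (by positivity) hf
  have hE'int := hH.integrable_rpow_mul_rpow (a := 2 + 2 * q) (b := 2 + 2 * q)
    (by positivity) (by positivity) hf
  have hEint : Integrable (fun x => S.tracelessNorm x ^ 2 * f x ^ (2 + 2 * q)) S.vol := by
    have := hH.integrable_rpow_mul_rpow (a := 2) (b := 2 + 2 * q) (by positivity) (by positivity) hf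
    simpa only [Real.rpow_two] using this
  have hGint : Integrable (fun x => S.tracelessNorm x ^ 2 * S.gradNorm f x ^ (2 + 2 * q))
      S.vol := by
    refine S.integrable_vol_of_continuous hf.2.1 ((hH.continuous_tracelessNorm.pow 2).mul
      ((S.continuous_gradNorm hf.1).rpow_const fun _ => Or.inr (by positivity))) fun x hx => ?_
    rw [S.gradNorm_eq_zero_of_notMem_tsupport hx, Real.zero_rpow (by positivity), mul_zero]
  have hstab := hH.stability_rpow hn hS hq0 hq1 hf
  have hsplit : ∫ x, (S.tracelessNorm x ^ 2 + n * H ^ 2)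
        * (S.tracelessNorm x ^ (2 + 2 * q) * f x ^ (2 + 2 * q)) ∂S.vol
      = (∫ x, S.tracelessNorm x ^ (4 + 2 * q) * f x ^ (2 + 2 * q) ∂S.vol)
        + n * H ^ 2 * ∫ x, S.tracelessNorm x ^ (2 + 2 * q) * f x ^ (2 + 2 * q) ∂S.vol := by
    rw [← integral_const_mul, ← integral_add hLint (hE'int.const_mul _)]
    refine integral_congr_ae (Filter.Eventually.of_forall fun x => ?_)
    have : S.tracelessNorm x ^ (4 + 2 * q)
        = S.tracelessNorm x ^ 2 * S.tracelessNorm x ^ (2 + 2 * q) := by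
      rw [← Real.rpow_two, ← Real.rpow_add_of_nonneg (hu0 x) (by positivity) (by positivity)]
      congr 1; ring
    simp only [this]; ring
  have hgr := hgrad f hf
  have hHG := integral_rpow_mul_rpow_le hq0 hLint hGint hL0 hG0
  have hHE := integral_rpow_mul_rpow_le hq0 hLint hEint hL0 hE0
  simp only [Real.rpow_mul_rpow_holder_split hq0 (hu0 _) (hf0 _) (hg0 _)] at hHG
  simp only [Real.rpow_mul_rpow_holder_split hq0 (hu0 _) (hf0 _) (hf0 _)] at hHE
  have hE'eq : ∀ x, S.tracelessNorm x ^ (2 + 2 * q) * f x ^ (2 * q) * f x ^ 2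
      = S.tracelessNorm x ^ (2 + 2 * q) * f x ^ (2 + 2 * q) := fun x => by
    rw [mul_assoc, ← Real.rpow_two,
      ← Real.rpow_add_of_nonneg (hf0 x) (by positivity) (by positivity),
      add_comm 2 (2 * q)]
  simp only [hE'eq] at hHE
  have hE'0 : 0 ≤ ∫ x, S.tracelessNorm x ^ (2 + 2 * q) * f x ^ (2 + 2 * q) ∂S.vol :=
    integral_nonneg fun x => mul_nonneg (Real.rpow_nonneg (hu0 x) _) (Real.rpow_nonneg (hf0 x) _)
  rw [hsplit] at hstab
  set L := ∫ x, S.tracelessNorm x ^ (4 + 2 * q) * f x ^ (2 + 2 * q) ∂S.vol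
  set E' := ∫ x, S.tracelessNorm x ^ (2 + 2 * q) * f x ^ (2 + 2 * q) ∂S.vol
  set I₁ := ∫ x, S.tracelessNorm x ^ (2 * q) * f x ^ (2 + 2 * q)
    * S.gradNorm S.tracelessNorm x ^ 2 ∂S.vol
  set I₂ := ∫ x, S.tracelessNorm x ^ (2 + 2 * q) * f x ^ (2 * q) * S.gradNorm f x ^ 2 ∂S.vol
  set G := ∫ x, S.tracelessNorm x ^ 2 * S.gradNorm f x ^ (2 + 2 * q) ∂S.vol
  set E := ∫ x, S.tracelessNorm x ^ 2 * f x ^ (2 + 2 * q) ∂S.vol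
  set b := max 0 (2 * (1 + q) ^ 2 * B₀ - (n : ℝ))
  have key : L ≤ 2 * (1 + q) ^ 2 * (C₀ + 1) * I₂ + b * H ^ 2 * E' := by
    have h1 : 2 * (1 + q) ^ 2 * (I₁ + I₂)
        ≤ 2 * (1 + q) ^ 2 * (C₀ * I₂ + B₀ * H ^ 2 * E' + I₂) := by gcongr
    have h2 : (2 * (1 + q) ^ 2 * B₀ - n) * (H ^ 2 * E') ≤ b * (H ^ 2 * E') := by
      gcongr
      exact le_max_right _ _
    linarith
  have hmain := Real.le_of_le_rpow_mul_add hq0 (integral_nonneg hL0) hGi hEi ha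
    (mul_nonneg hb (sq_nonneg H)) (key.trans (add_le_add
      (mul_le_mul_of_nonneg_left hHG ha)
      (mul_le_mul_of_nonneg_left hHE (mul_nonneg hb (sq_nonneg H)))))
  -- `b H²` is the second coefficient, as `(H²)^{1+q} = |H|^{2+2q}`
  have hHpow : (b * H ^ 2) ^ (1 + q) = b ^ (1 + q) * |H| ^ (2 + 2 * q) := by
    rw [Real.mul_rpow hb (sq_nonneg H), ← sq_abs, ← Real.rpow_two, ← Real.rpow_mul (abs_nonneg H)]
    congr 2; ring
  rw [hHpow] at hmain
  linarith
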